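/- Let $m\ge 2$ be an integer and let $g:[0,2\pi]\to\mathbb{R}$ be continuous, three times continuously differentiable in a neighbourhood of $\frac{2\pi}{m}$, with $g''\left(\frac{2\pi}{m}\right)\neq 0$. For points $u_1,\dots,u_m$ of the unit circle $S^1$, let $0=\beta_0\le\beta_1\le\dots\le\beta_{m-1}<2\pi$ be the counterclockwise angles from $u_1$ to $u_1,\dots,u_m$, arranged in increasing order, put $\beta_m=2\pi$, and define $$f(u_1,\dots,u_m)=\sum_{i=1}^{m} g(\beta_i-\beta_{i-1}).$$ Let $p:\mathbb{R}\to[0,\infty)$ be continuous and $2\pi$-periodic with $\int_0^{2\pi}p(x)\,dx=1$ and $\int_0^{2\pi}\prod_{l=0}^{m-1}p\left(x+\frac{2\pi l}{m}\right)dx>0$, let $U_1,U_2,\dots$ be independent random points of $S^1$ whose polar angles have the common density $p$, and for $n\ge m$ let $$H_n=\min_{1\le i_1<\dots<i_m\le n} f(U_{i_1},\dots,U_{i_m}).$$ (i) Suppose that $f$ attains its minimum over $(S^1)^m$ exactly at those $m$-tuples whose points are, in some order, the vertices of a regular $m$-gon. Then for every $t>0$ $$\lim_{n\to\infty}\mathbb{P}\left\{n^{\frac{2m}{m-1}}\left(H_n-m\,g\left(\tfrac{2\pi}{m}\right)\right)\le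 t\right\}=1-\exp\left(-\frac{t^{\frac{m-1}{2}}K}{m}\right),$$ where $$K=\frac{(2\pi)^{\frac{m-1}{2}}\displaystyle\int_0^{2\pi}\prod_{l=0}^{m-1}p\left(x+\tfrac{2\pi l}{m}\right)dx}{\left(g''\left(\frac{2\pi}{m}\right)\right)^{\frac{m-1}{2}}\,\Gamma\left(\frac{m+1}{2}\right)\sqrt{m}}.$$ (ii) If $g$ is strictly convex on $[0,2\pi]$, then $f$ attains its minimum exactly at the $m$-tuples formed by the vertices of a regular $m$-gon, so the limit relation of (i) holds. -/

import Mathlib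

open MeasureTheory ProbabilityTheory Filter Topology Set

noncomputable section

namespace UMin

instance : MeasurableSpace Circle := borel Circle

instance : BorelSpace Circle := ⟨rfl⟩

/-- The angle in `[0, 2π)` from the point `z` to the point `w` of the unit circle,
taken counterclockwise. -/
def centralAngle (z w : Circle) : ℝ :=
  toIcoMod Real.two_pi_pos 0 (Complex.arg ((w / z : Circle) : ℂ))

/-- For angles `β 0, …, β (m - 1)`, the increasing rearrangement
`β₍₀₎ ≤ β₍₁₎ ≤ … ≤ β₍ₘ₋₁₎` followed by `β₍ₘ₎ = 2π`. -/
def orderedAngles {m : ℕ} (β : Fin m → ℝ) : Fin (m + 1) → ℝ :=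
  Fin.snoc (α := fun _ => ℝ) (β ∘ Tuple.sort β) (2 * Real.pi)

/-- The symmetric function `h(β) = ∑_{i=1}^m g (β₍ᵢ₎ - β₍ᵢ₋₁₎)` of the ordered angles. -/
def gapSum {m : ℕ} (g : ℝ → ℝ) (β : Fin m → ℝ) : ℝ :=
  ∑ i : Fin m, g (orderedAngles β i.succ - orderedAngles β i.castSucc)

/-- The kernel `f(U₁, …, Uₘ)`: the sum of the values of `g` at the consecutive arcs into which the
points divide the circle. The angles are measured from the first point, so that the smallest
one is `β₍₀₎ = 0`. -/
def kernel {m : ℕ} [NeZero m] (g : ℝ → ℝ) (u : Fin m → Circle) : ℝ :=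
  gapSum g fun i => centralAngle (u 0) (u i)

/-- The points `u 0, …, u (m - 1)` are, in some order, the vertices of a regular `m`-gon inscribed
in the unit circle. -/
def IsRegularPolygon {m : ℕ} (u : Fin m → Circle) : Prop :=
  ∃ (z : Circle) (σ : Equiv.Perm (Fin m)), ∀ i,
    u i = z * Circle.exp (2 * Real.pi * ((σ i : ℕ) : ℝ) / (m : ℝ))

/-- The regular `m`-gon is the only point of minimum of the kernel, up to rotation and the order
of the vertices. -/
def RegularPolygonUniqueMin (m : ℕ) [NeZero m] (g : ℝ → ℝ) : Prop :=
  ∀ u : Fin m → Circle, IsMinOn (kernel g) univ u ↔ IsRegularPolygon u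

/-- The measure on the unit circle with density `p` (a function of the polar angle) with respect
to arc length. -/
def circleLaw (p : ℝ → ℝ) : Measure Circle :=
  ((volume.restrict (Ico 0 (2 * Real.pi))).withDensity fun x => ENNReal.ofReal (p x)).map
    Circle.exp

/-- The `U`-min statistic: the minimum of `f (x_{i₁}, …, x_{iₘ})` over all `i₁ < … < iₘ` among the
first `n` indices. It is meaningful for `n ≥ m`, when the finite index type is non-empty. -/
def uMin {α : Type*} {m : ℕ} (f : (Fin m → α) → ℝ) (x : ℕ → α) (n : ℕ) : ℝ :=
  ⨅ J : Fin m ↪o Fin n, f fun k => x (J k : ℕ)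

/-- `∫₀^{2π} ∏_{l=0}^{m-1} p (x + 2πl/m) dx`. -/
def polygonIntegral (m : ℕ) (p : ℝ → ℝ) : ℝ :=
  ∫ x in (0 : ℝ)..(2 * Real.pi), ∏ l ∈ Finset.range m, p (x + 2 * Real.pi * (l : ℝ) / (m : ℝ))

/-- The constant `K` of the limit law. -/
def limitConst (m : ℕ) (g p : ℝ → ℝ) : ℝ :=
  (2 * Real.pi) ^ (((m : ℝ) - 1) / 2) * polygonIntegral m p /
    ((iteratedDeriv 2 g (2 * Real.pi / (m : ℝ))) ^ (((m : ℝ) - 1) / 2) *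
      Real.Gamma (((m : ℝ) + 1) / 2) * Real.sqrt (m : ℝ))

end UMin

end

open MeasureTheory ProbabilityTheory Filter Topology Set

noncomputable section

namespace UMin

/-! ### Angles and gaps -/

/-! Write `m = d + 1` and `a = 2π/m`. The kernel depends on the points only through the arcs `e`,
which form a nonnegative vector of sum `2π`, and equals `∑ g (e i)`. The deviations `e i - a` sum to
zero, so the linear Taylor terms cancel and the excess over `m g(a)` is `g''(a)/2 · ∑ (e i - a)²` to
leading order. Minimality together with `g''(a) ≠ 0` gives `g''(a) > 0`, and compactness of the
simplex then bounds the excess below everywhere by a multiple of `∑ (e i - a)²`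
(`exists_quadratic_growth`). Part (ii) is Jensen's inequality with its equality case.

For (i), take `η = √t · n^(-m/d)`. The rescaled minimum exceeds `t` exactly when no `m`-tuple has
excess at most `η²`, and the number of such tuples is asymptotically Poisson.

Mean: the angles from one point to the others have density `angleDensity`. Symmetry gives a factor
`d!`, and rescaling by `η` around the regular polygon turns the sublevel set into an ellipsoid, so a
single tuple succeeds with probability about `d! K η^d` (`tendsto_pi_circleLaw_kernel_le`).
Multiplying by `n^m / m!` and using `n^m η^d = t^(d/2)` gives the mean `t^(d/2) K / m`.

Dependence: tuples without a common index are independent. If the excess is at most `η²`, the `m`-th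
powers of the points lie within `O(η)` of each other, since taking `m`-th powers collapses a regular
polygon to one point (`exists_dist_pow_le`). Two successful overlapping tuples with `s` indices in
total therefore have all `s` powers close to a common one, which has probability `O(η^(s-1))`. There
are `O(n^s)` such pairs, and `n^s η^(s-1) → 0` precisely when `s > m`, that is, for distinct tuples.
The bound `abs_prob_none_sub_exp_le` turns this into the limit. -/

theorem centralAngle_mem_Ico (z w : Circle) : centralAngle z w ∈ Ico 0 (2 * Real.pi) :=
  toIcoMod_mem_Ico' _ _

theorem exp_centralAngle (z w : Circle) : Circle.exp (centralAngle z w) = w / z := by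
  conv_rhs => rw [← Circle.exp_arg (w / z)]
  rw [Circle.exp_eq_exp]
  refine ⟨-toIcoDiv Real.two_pi_pos 0 (Complex.arg ((w / z : Circle) : ℂ)), ?_⟩
  rw [centralAngle, toIcoMod]
  simp only [zsmul_eq_mul]
  push_cast
  ring

theorem mul_exp_centralAngle (z w : Circle) : z * Circle.exp (centralAngle z w) = w := by
  rw [exp_centralAngle, mul_div_cancel]

theorem centralAngle_mul_exp (z : Circle) {s : ℝ} (hs : s ∈ Ico 0 (2 * Real.pi)) :
    centralAngle z (z * Circle.exp s) = s := by
  refine Circle.exp_injOn_Ico (a := 0) (b := 2 * Real.pi) (by simp)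
    (centralAngle_mem_Ico _ _) hs ?_
  rw [exp_centralAngle, mul_div_cancel_left]

theorem centralAngle_self (z : Circle) : centralAngle z z = 0 := by
  simpa using centralAngle_mul_exp z (s := 0) ⟨le_rfl, Real.two_pi_pos⟩

/-- The consecutive arcs cut out by the angles `β`. -/
def gap {m : ℕ} (β : Fin m → ℝ) (i : Fin m) : ℝ :=
  orderedAngles β i.succ - orderedAngles β i.castSucc

theorem gapSum_eq_sum_gap {m : ℕ} (g : ℝ → ℝ) (β : Fin m → ℝ) :
    gapSum g β = ∑ i, g (gap β i) := rfl

theorem orderedAngles_castSucc {m : ℕ} (β : Fin m → ℝ) (i : Fin m) :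
    orderedAngles β i.castSucc = β (Tuple.sort β i) := by
  simp [orderedAngles]

theorem orderedAngles_last {m : ℕ} (β : Fin m → ℝ) :
    orderedAngles β (Fin.last m) = 2 * Real.pi := by
  simp [orderedAngles]

theorem orderedAngles_of_monotone {m : ℕ} {β : Fin m → ℝ} (h : Monotone β) :
    orderedAngles β = Fin.snoc (α := fun _ => ℝ) β (2 * Real.pi) := by
  rw [orderedAngles, Tuple.sort_eq_refl_iff_monotone.2 h]
  rfl

theorem orderedAngles_comp_perm {m : ℕ} (β : Fin m → ℝ) (σ : Equiv.Perm (Fin m)) :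
    orderedAngles (β ∘ σ) = orderedAngles β := by
  rw [orderedAngles, orderedAngles, Tuple.comp_perm_comp_sort_eq_comp_sort]

theorem gap_comp_perm {m : ℕ} (β : Fin m → ℝ) (σ : Equiv.Perm (Fin m)) :
    gap (β ∘ σ) = gap β := by
  funext i
  rw [gap, gap, orderedAngles_comp_perm]

theorem sum_fin_succ_sub_castSucc {n : ℕ} (f : Fin (n + 1) → ℝ) :
    ∑ i : Fin n, (f i.succ - f i.castSucc) = f (Fin.last n) - f 0 := by
  have h := (Fin.sum_univ_succ f).symm.trans (Fin.sum_univ_castSucc f)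
  rw [Finset.sum_sub_distrib]
  linarith

/-- The possible vectors of arcs: non-negative vectors with sum `2π`. -/
def arcSimplex (m : ℕ) : Set (Fin m → ℝ) :=
  {e | (∀ i, 0 ≤ e i) ∧ ∑ i, e i = 2 * Real.pi}

theorem orderedAngles_monotone {m : ℕ} {β : Fin m → ℝ} (h : ∀ i, β i ≤ 2 * Real.pi) :
    Monotone (orderedAngles β) := by
  intro i j hij
  induction j using Fin.lastCases with
  | last =>
    rw [orderedAngles_last]
    induction i using Fin.lastCases with
    | last => rw [orderedAngles_last]
    | cast i => rw [orderedAngles_castSucc]; exact h _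
  | cast j =>
    induction i using Fin.lastCases with
    | last => exact absurd hij (not_le.2 (Fin.castSucc_lt_last j))
    | cast i =>
      rw [orderedAngles_castSucc, orderedAngles_castSucc]
      exact Tuple.monotone_sort β (by simpa using hij)

theorem orderedAngles_zero {d : ℕ} {β : Fin (d + 1) → ℝ} (h0 : ∀ i, 0 ≤ β i)
    (hβ : ∃ i, β i = 0) : orderedAngles β 0 = 0 := by
  obtain ⟨i, hi⟩ := hβ
  have h1 : orderedAngles β 0 = β (Tuple.sort β 0) := orderedAngles_castSucc β 0
  rw [h1]
  refine le_antisymm ?_ (h0 _)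
  have := Tuple.monotone_sort β (Fin.zero_le ((Tuple.sort β).symm i))
  simpa [hi] using this

theorem gap_mem_arcSimplex {d : ℕ} {β : Fin (d + 1) → ℝ}
    (h : ∀ i, β i ∈ Ico 0 (2 * Real.pi)) (hβ : ∃ i, β i = 0) :
    gap β ∈ arcSimplex (d + 1) := by
  refine ⟨fun i => sub_nonneg.2 (orderedAngles_monotone (fun i => (h i).2.le)
    Fin.castSucc_lt_succ.le), ?_⟩
  simp only [gap]
  rw [sum_fin_succ_sub_castSucc, orderedAngles_last, orderedAngles_zero (fun i => (h i).1) hβ,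
    sub_zero]

/-- The vector of arcs of a configuration of points on the circle. -/
def arcs {d : ℕ} (u : Fin (d + 1) → Circle) : Fin (d + 1) → ℝ :=
  gap fun i => centralAngle (u 0) (u i)

theorem kernel_eq_sum_arcs {d : ℕ} (g : ℝ → ℝ) (u : Fin (d + 1) → Circle) :
    kernel g u = ∑ i, g (arcs u i) := rfl

theorem arcs_mem_arcSimplex {d : ℕ} (u : Fin (d + 1) → Circle) : arcs u ∈ arcSimplex (d + 1) :=
  gap_mem_arcSimplex (fun _ => centralAngle_mem_Ico _ _) ⟨0, centralAngle_self _⟩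

theorem mem_Icc_of_mem_arcSimplex {m : ℕ} {e : Fin m → ℝ} (he : e ∈ arcSimplex m) (i : Fin m) :
    e i ∈ Icc 0 (2 * Real.pi) :=
  ⟨he.1 i, he.2 ▸ Finset.single_le_sum (fun j _ => he.1 j) (Finset.mem_univ i)⟩

theorem orderedAngles_eq_mul_of_gap {d : ℕ} {β : Fin (d + 1) → ℝ} {a : ℝ}
    (h0 : orderedAngles β 0 = 0) (h : ∀ i, gap β i = a) (k : Fin (d + 2)) :
    orderedAngles β k = (k : ℕ) * a := by
  induction k using Fin.induction with
  | zero => simpa using h0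
  | succ i ih =>
    have := h i
    rw [gap, ih] at this
    rw [sub_eq_iff_eq_add.1 this]
    simp
    ring

/-- Seen from the vertex `u 0`, the angles of a regular polygon are a permutation of the multiples
of `2π/m`, and sorting forgets the permutation. Conversely, equal arcs force the sorted angles to be
these multiples, and the inverse of the sorting permutation labels the vertices. -/
theorem isRegularPolygon_iff_arcs {d : ℕ} (u : Fin (d + 1) → Circle) :
    IsRegularPolygon u ↔ ∀ i, arcs u i = 2 * Real.pi / ((d + 1 : ℕ) : ℝ) := by
  have hm : ((d + 1 : ℕ) : ℝ) ≠ 0 := by positivity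
  constructor
  · rintro ⟨z, σ, hσ⟩
    -- The labelling is shifted cyclically so that `u 0` receives the label `0`.
    let τ : Equiv.Perm (Fin (d + 1)) := σ.trans (Equiv.subRight (σ 0))
    have hexp (k : ℕ) : Circle.exp (2 * Real.pi * ((k % (d + 1) : ℕ) : ℝ) / ((d + 1 : ℕ) : ℝ))
        = Circle.exp (2 * Real.pi * (k : ℝ) / ((d + 1 : ℕ) : ℝ)) := by
      rw [Circle.exp_eq_exp]
      refine ⟨-((k / (d + 1) : ℕ) : ℤ), ?_⟩
      have : (k : ℝ) = ((d + 1 : ℕ) : ℝ) * ((k / (d + 1) : ℕ) : ℝ) + ((k % (d + 1) : ℕ) : ℝ) := by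
        exact_mod_cast (Nat.div_add_mod k (d + 1)).symm
      rw [this]
      generalize k / (d + 1) = q
      generalize k % (d + 1) = r
      push_cast
      field_simp
      ring
    have hu (i) : u i = u 0 * Circle.exp (2 * Real.pi * ((τ i : ℕ) : ℝ) / ((d + 1 : ℕ) : ℝ)) := by
      have hτ : (τ i : ℕ) = (d + 1 - (σ 0 : ℕ) + (σ i : ℕ)) % (d + 1) := by
        simp [τ, Fin.sub_def]
      rw [hτ, hexp, hσ i, hσ 0, mul_assoc z, ← Circle.exp_add]
      congr 1
      -- Subtraction in `Fin` is expressed through `d + 1 - σ 0 + σ i`, which contributes one extra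
      -- full turn.
      rw [← Circle.exp_add_two_pi]
      congr 1
      have hsub : ((d + 1 - (σ 0 : ℕ) + (σ i : ℕ) : ℕ) : ℝ) =
          ((d + 1 : ℕ) : ℝ) + ((σ i : ℕ) : ℝ) - ((σ 0 : ℕ) : ℝ) := by
        have h := (σ 0).is_lt.le
        rw [eq_sub_iff_add_eq]
        exact_mod_cast (by omega : d + 1 - (σ 0 : ℕ) + (σ i : ℕ) + (σ 0 : ℕ) = d + 1 + (σ i : ℕ))
      rw [hsub]
      field_simp
      ring
    have hβ : (fun i => centralAngle (u 0) (u i)) =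
        fun i => 2 * Real.pi * ((τ i : ℕ) : ℝ) / ((d + 1 : ℕ) : ℝ) := by
      funext i
      rw [hu i]
      refine centralAngle_mul_exp _ ⟨by positivity, ?_⟩
      rw [div_lt_iff₀ (by positivity)]
      have : ((τ i : ℕ) : ℝ) < ((d + 1 : ℕ) : ℝ) := by exact_mod_cast (τ i).is_lt
      exact mul_lt_mul_of_pos_left this Real.two_pi_pos
    intro i
    let b : Fin (d + 1) → ℝ := fun i => 2 * Real.pi * ((i : ℕ) : ℝ) / ((d + 1 : ℕ) : ℝ)
    have hb : Monotone b := by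
      intro i j hij
      have : ((i : ℕ) : ℝ) ≤ ((j : ℕ) : ℝ) := by exact_mod_cast hij
      simp only [b]
      gcongr
    have hk (k : Fin (d + 2)) :
        orderedAngles b k = 2 * Real.pi * ((k : ℕ) : ℝ) / ((d + 1 : ℕ) : ℝ) := by
      rw [orderedAngles_of_monotone hb]
      induction k using Fin.lastCases with
      | last => simp; field_simp
      | cast k => simp [b]
    have : arcs u = gap b := by
      rw [arcs, hβ]
      exact gap_comp_perm b τ
    rw [this, gap, hk, hk]
    simp only [Fin.val_succ, Fin.val_castSucc]
    push_cast
    ring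
  · intro h
    set β : Fin (d + 1) → ℝ := fun i => centralAngle (u 0) (u i) with hβ
    have h0 : orderedAngles β 0 = 0 :=
      orderedAngles_zero (fun i => (centralAngle_mem_Ico _ _).1) ⟨0, centralAngle_self _⟩
    refine ⟨u 0, (Tuple.sort β).symm, fun i => ?_⟩
    have h1 := orderedAngles_eq_mul_of_gap h0 h ((Tuple.sort β).symm i).castSucc
    rw [orderedAngles_castSucc, Equiv.apply_symm_apply] at h1
    rw [← mul_exp_centralAngle (u 0) (u i)]
    congr 2
    change β i = _
    rw [h1]
    simp only [Fin.val_castSucc]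
    ring

/-- The points are placed at the partial sums of `e`. Positivity of the last arc keeps all these
angles strictly below `2π`; otherwise the last point would wrap around to angle `0`. -/
theorem exists_arcs_eq {d : ℕ} {e : Fin (d + 1) → ℝ} (he : e ∈ arcSimplex (d + 1))
    (hlast : 0 < e (Fin.last d)) : ∃ u : Fin (d + 1) → Circle, arcs u = e := by
  let β : Fin (d + 1) → ℝ := fun k => Fin.partialSum e k.castSucc
  have hmono : Monotone (Fin.partialSum e) := by
    rw [Fin.monotone_iff_le_succ]
    intro i
    rw [Fin.partialSum_succ]
    linarith [he.1 i]
  have hlastsum : Fin.partialSum e (Fin.last (d + 1)) = 2 * Real.pi := by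
    have h := sum_fin_succ_sub_castSucc (Fin.partialSum e)
    simp only [Fin.partialSum_succ, add_sub_cancel_left, Fin.partialSum_zero, sub_zero] at h
    rw [← h, he.2]
  have hβm : Monotone β := fun i j hij => hmono (by simpa using hij)
  have hβ (k) : β k ∈ Ico 0 (2 * Real.pi) := by
    refine ⟨?_, ?_⟩
    · simpa using hmono (Fin.zero_le k.castSucc)
    · have h1 : β k ≤ β (Fin.last d) := hβm (Fin.le_last k)
      have h2 : Fin.partialSum e (Fin.last d).succ = β (Fin.last d) + e (Fin.last d) :=
        Fin.partialSum_succ e _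
      rw [Fin.succ_last, hlastsum] at h2
      linarith
  refine ⟨fun k => Circle.exp (β k), ?_⟩
  have hβ0 : β 0 = 0 := by simp [β]
  have hang : (fun i => centralAngle (Circle.exp (β 0)) (Circle.exp (β i))) = β := by
    funext i
    have := centralAngle_mul_exp (Circle.exp (β 0)) (hβ i)
    rwa [hβ0, Circle.exp_zero, one_mul, ← Circle.exp_zero, ← hβ0] at this
  have hord : orderedAngles β = Fin.partialSum e := by
    rw [orderedAngles_of_monotone hβm]
    funext k
    induction k using Fin.lastCases with
    | last => simp [hlastsum]
    | cast k => simp [β]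
  rw [arcs, hang]
  funext i
  rw [gap, hord, Fin.partialSum_succ]
  ring

/-- Some arc is positive because the sum is `2π`; it is swapped into the last place. The permutation
is harmless, as `∑ g (e i)` is symmetric. -/
theorem exists_arcs_eq_perm {d : ℕ} {e : Fin (d + 1) → ℝ} (he : e ∈ arcSimplex (d + 1)) :
    ∃ (u : Fin (d + 1) → Circle) (σ : Equiv.Perm (Fin (d + 1))), arcs u = e ∘ σ := by
  obtain ⟨j, hj⟩ : ∃ j, 0 < e j := by
    by_contra! h
    have := Finset.sum_nonpos (fun i (_ : i ∈ Finset.univ) => h i)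
    rw [he.2] at this
    linarith [Real.two_pi_pos]
  let σ := Equiv.swap j (Fin.last d)
  obtain ⟨u, hu⟩ := exists_arcs_eq (e := e ∘ σ)
    ⟨fun i => he.1 _, by rw [← he.2]; exact Equiv.sum_comp σ e⟩ (by simpa [σ] using hj)
  exact ⟨u, σ, hu⟩

theorem const_mem_arcSimplex (d : ℕ) :
    (fun _ => 2 * Real.pi / ((d + 1 : ℕ) : ℝ)) ∈ arcSimplex (d + 1) := by
  refine ⟨fun _ => by positivity, ?_⟩
  simp only [Finset.sum_const, Finset.card_univ, Fintype.card_fin, nsmul_eq_mul]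
  field_simp

/-- Unique minimality of the regular polygon, expressed on the simplex of arcs. -/
theorem regularPolygonUniqueMin_iff {d : ℕ} (g : ℝ → ℝ) :
    RegularPolygonUniqueMin (d + 1) g ↔ ∀ e ∈ arcSimplex (d + 1),
      ((d + 1 : ℕ) : ℝ) * g (2 * Real.pi / ((d + 1 : ℕ) : ℝ)) ≤ ∑ i, g (e i) ∧
      (∑ i, g (e i) = ((d + 1 : ℕ) : ℝ) * g (2 * Real.pi / ((d + 1 : ℕ) : ℝ)) →
        ∀ i, e i = 2 * Real.pi / ((d + 1 : ℕ) : ℝ)) := by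
  set a := 2 * Real.pi / ((d + 1 : ℕ) : ℝ) with ha
  have hreg (u : Fin (d + 1) → Circle) (hu : ∀ i, arcs u i = a) :
      kernel g u = ((d + 1 : ℕ) : ℝ) * g a := by
    simp [kernel_eq_sum_arcs, hu]
  constructor
  · intro H e he
    obtain ⟨u, σ, hu⟩ := exists_arcs_eq_perm he
    obtain ⟨v, τ, hv⟩ := exists_arcs_eq_perm (const_mem_arcSimplex d)
    have hv' : ∀ i, arcs v i = a := fun i => by rw [hv]; rfl
    have hk : kernel g u = ∑ i, g (e i) := by
      rw [kernel_eq_sum_arcs, hu]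
      exact Equiv.sum_comp σ (fun i => g (e i))
    have hmin := (H v).2 ((isRegularPolygon_iff_arcs v).2 hv')
    have hle (w : Fin (d + 1) → Circle) : ((d + 1 : ℕ) : ℝ) * g a ≤ kernel g w := by
      rw [← hreg v hv']
      exact hmin (mem_univ w)
    refine ⟨hk ▸ hle u, fun heq i => ?_⟩
    have humin : IsMinOn (kernel g) univ u := fun w _ => by
      change kernel g u ≤ kernel g w
      rw [hk, heq]
      exact hle w
    have := (isRegularPolygon_iff_arcs u).1 ((H u).1 humin) (σ.symm i)
    rwa [hu, Function.comp_apply, Equiv.apply_symm_apply] at this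
  · intro H u
    rw [isRegularPolygon_iff_arcs]
    constructor
    · intro hmin
      refine (H _ (arcs_mem_arcSimplex u)).2 (le_antisymm ?_ (H _ (arcs_mem_arcSimplex u)).1)
      obtain ⟨v, τ, hv⟩ := exists_arcs_eq_perm (const_mem_arcSimplex d)
      rw [← hreg v (fun i => by rw [hv]; rfl), ← kernel_eq_sum_arcs]
      exact hmin (mem_univ v)
    · intro hu w _
      change kernel g u ≤ kernel g w
      rw [hreg u hu]
      exact (H _ (arcs_mem_arcSimplex w)).1

/-- Jensen's inequality with equal weights: the mean arc is always `2π/m`, and strict convexity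
makes equality force all arcs to equal their mean. -/
theorem regularPolygonUniqueMin_of_strictConvexOn {d : ℕ} {g : ℝ → ℝ}
    (hg : StrictConvexOn ℝ (Icc 0 (2 * Real.pi)) g) : RegularPolygonUniqueMin (d + 1) g := by
  rw [regularPolygonUniqueMin_iff]
  intro e he
  have hm : (0 : ℝ) < ((d + 1 : ℕ) : ℝ) := by positivity
  have hw : ∑ _i : Fin (d + 1), (((d + 1 : ℕ) : ℝ))⁻¹ = 1 := by
    simp only [Finset.sum_const, Finset.card_univ, Fintype.card_fin, nsmul_eq_mul]
    field_simp
  have hmem : ∀ i ∈ Finset.univ, e i ∈ Icc 0 (2 * Real.pi) :=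
    fun i _ => mem_Icc_of_mem_arcSimplex he i
  have hmean : ∑ i, (((d + 1 : ℕ) : ℝ))⁻¹ • e i = 2 * Real.pi / ((d + 1 : ℕ) : ℝ) := by
    rw [← Finset.smul_sum, he.2, smul_eq_mul, div_eq_inv_mul]
  have hmean' : ∑ i, (((d + 1 : ℕ) : ℝ))⁻¹ • g (e i) =
      (((d + 1 : ℕ) : ℝ))⁻¹ * ∑ i, g (e i) := by
    rw [← Finset.smul_sum, smul_eq_mul]
  constructor
  · have h := hg.convexOn.map_sum_le (t := Finset.univ) (w := fun _ => (((d + 1 : ℕ) : ℝ))⁻¹)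
      (p := e) (fun _ _ => by positivity) hw hmem
    rw [hmean, hmean'] at h
    rw [← le_inv_mul_iff₀ hm]
    exact h
  · intro heq
    have h := (hg.map_sum_eq_iff (t := Finset.univ) (w := fun _ => (((d + 1 : ℕ) : ℝ))⁻¹)
      (p := e) (fun _ _ => by positivity) hw hmem).1
      (by rw [hmean, hmean', heq]; field_simp)
    intro i
    rw [h i (Finset.mem_univ i), hmean]

/-! ### Local and global behaviour of the sum over the arcs -/

theorem isLittleO_taylor_two {g : ℝ → ℝ} {a : ℝ} (h : ContDiffAt ℝ 2 g a) :
    (fun x => g (a + x) - g a - deriv g a * x - iteratedDeriv 2 g a / 2 * x ^ 2)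
      =o[𝓝 0] fun x => x ^ 2 := by
  obtain ⟨u, hu, hgu⟩ := h.contDiffOn le_rfl (by simp)
  obtain ⟨r, hr, hru⟩ := Metric.mem_nhds_iff.1 hu
  have ha : a ∈ Metric.ball a r := Metric.mem_ball_self hr
  have ht := taylor_isLittleO (n := 2) (convex_ball a r) ha (hgu.mono hru)
  rw [Metric.isOpen_ball.nhdsWithin_eq ha] at ht
  have hc : Tendsto (fun x : ℝ => a + x) (𝓝 0) (𝓝 a) := by
    have : Continuous fun x : ℝ => a + x := by fun_prop
    simpa using this.tendsto 0
  refine (ht.comp_tendsto hc).congr (fun x => ?_) (fun x => by simp)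
  simp only [Function.comp_apply, taylorWithinEval_succ, taylor_within_zero_eval,
    iteratedDerivWithin_of_isOpen Metric.isOpen_ball ha]
  simp
  ring

theorem isCompact_arcSimplex (m : ℕ) : IsCompact (arcSimplex m) := by
  refine (isCompact_Icc (a := fun _ : Fin m => (0 : ℝ)) (b := fun _ => 2 * Real.pi)).of_isClosed_subset
    ?_ fun e he => ⟨fun i => (mem_Icc_of_mem_arcSimplex he i).1,
      fun i => (mem_Icc_of_mem_arcSimplex he i).2⟩
  have : arcSimplex m = (⋂ i, {e : Fin m → ℝ | 0 ≤ e i}) ∩ {e | ∑ i, e i = 2 * Real.pi} := by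
    ext e
    simp [arcSimplex]
  rw [this]
  exact (isClosed_iInter fun i => isClosed_le continuous_const (continuous_apply i)).inter
    (isClosed_eq (by fun_prop) continuous_const)

/-- The linear terms drop out because the deviations sum to zero. This makes the excess purely
quadratic at leading order, whatever the value of `deriv g a`. -/
theorem sum_taylor_two {m : ℕ} (g : ℝ → ℝ) (a : ℝ) {e : Fin m → ℝ} (he : ∑ i, (e i - a) = 0) :
    ∑ i, (g (a + (e i - a)) - g a - deriv g a * (e i - a) - iteratedDeriv 2 g a / 2 * (e i - a) ^ 2)
      = ∑ i, g (e i) - m * g a - iteratedDeriv 2 g a / 2 * ∑ i, (e i - a) ^ 2 := by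
  rw [Finset.sum_sub_distrib, Finset.sum_sub_distrib, ← Finset.mul_sum, ← Finset.mul_sum, he]
  simp [Finset.sum_sub_distrib]

theorem sum_sub_mean_of_mem {d : ℕ} {e : Fin (d + 1) → ℝ} (he : e ∈ arcSimplex (d + 1)) :
    ∑ i, (e i - 2 * Real.pi / ((d + 1 : ℕ) : ℝ)) = 0 := by
  rw [Finset.sum_sub_distrib, he.2, (const_mem_arcSimplex d).2, sub_self]

/-- At a minimum at the regular polygon, the second derivative is non-negative. -/
theorem iteratedDeriv_two_nonneg {d : ℕ} (hd : 1 ≤ d) {g : ℝ → ℝ}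
    (hg : ContDiffAt ℝ 2 g (2 * Real.pi / ((d + 1 : ℕ) : ℝ)))
    (hmin : RegularPolygonUniqueMin (d + 1) g) :
    0 ≤ iteratedDeriv 2 g (2 * Real.pi / ((d + 1 : ℕ) : ℝ)) := by
  rw [regularPolygonUniqueMin_iff] at hmin
  set a := 2 * Real.pi / ((d + 1 : ℕ) : ℝ) with ha
  have ha0 : 0 < a := by positivity
  by_contra! hneg
  set c := iteratedDeriv 2 g a with hc
  -- With this tolerance the remainder is at most half the size of the quadratic term `c/2 · x²`, so
  -- the sum of two such terms stays negative.
  have hO := (isLittleO_taylor_two hg).def (c := -c / 4) (by linarith)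
  rw [Metric.eventually_nhds_iff] at hO
  obtain ⟨r, hr, hO⟩ := hO
  set x := min (r / 2) a with hx
  have hx0 : 0 < x := lt_min (by linarith) ha0
  have hxr : x < r := (min_le_left _ _).trans_lt (by linarith)
  have h1 := hO (y := x) (by simpa [abs_of_pos hx0] using hxr)
  have h2 := hO (y := -x) (by simpa [abs_of_pos hx0] using hxr)
  rw [Real.norm_eq_abs, abs_le, Real.norm_eq_abs, abs_of_nonneg (by positivity)] at h1 h2
  have h01 : (0 : Fin (d + 1)) ≠ Fin.last d := by
    rw [Ne, Fin.ext_iff]; simp; omega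
  let s : Fin (d + 1) → ℝ := fun i => (if i = 0 then x else 0) + (if i = Fin.last d then -x else 0)
  have hs : ∑ i, s i = 0 := by simp [s, Finset.sum_add_distrib]
  have hG (φ : ℝ → ℝ) (hφ : φ 0 = 0) : ∑ i, φ (s i) = φ x + φ (-x) := by
    have : ∀ i, φ (s i) = (if i = 0 then φ x else 0) + (if i = Fin.last d then φ (-x) else 0) := by
      intro i
      by_cases hi : i = 0
      · subst hi; simp [s, h01]
      · by_cases hi' : i = Fin.last d
        · subst hi'; simp [s, hi]
        · simp [s, hi, hi', hφ]
    simp [this, Finset.sum_add_distrib]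
  have hmem : (fun i => a + s i) ∈ arcSimplex (d + 1) := by
    refine ⟨fun i => ?_, ?_⟩
    · have : -x ≤ s i := by
        by_cases hi : i = 0
        · subst hi; simp [s, h01]; linarith
        · by_cases hi' : i = Fin.last d
          · subst hi'; simp [s, hi]
          · simp [s, hi, hi']; linarith
      have := min_le_right (r / 2) a
      simp only
      linarith
    · rw [Finset.sum_add_distrib, hs, add_zero]
      exact (const_mem_arcSimplex d).2
  have h3 := (hmin _ hmem).1
  have h4 := hG (fun y => g (a + y) - g a) (by simp)
  rw [Finset.sum_sub_distrib] at h4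
  simp only [Finset.sum_const, Finset.card_univ, Fintype.card_fin, nsmul_eq_mul] at h4
  nlinarith [sq_pos_of_pos hx0, h1.2, h2.2]

/-- Quadratic growth of the sum over the arcs away from its minimum. -/
theorem exists_quadratic_growth {d : ℕ} {g : ℝ → ℝ} (hgc : Continuous g)
    (hg : ContDiffAt ℝ 2 g (2 * Real.pi / ((d + 1 : ℕ) : ℝ)))
    (hpos : 0 < iteratedDeriv 2 g (2 * Real.pi / ((d + 1 : ℕ) : ℝ)))
    (hmin : RegularPolygonUniqueMin (d + 1) g) :
    ∃ κ : ℝ, 0 < κ ∧ ∀ e ∈ arcSimplex (d + 1),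
      κ * ∑ i, (e i - 2 * Real.pi / ((d + 1 : ℕ) : ℝ)) ^ 2 ≤
        ∑ i, g (e i) - ((d + 1 : ℕ) : ℝ) * g (2 * Real.pi / ((d + 1 : ℕ) : ℝ)) := by
  rw [regularPolygonUniqueMin_iff] at hmin
  set a := 2 * Real.pi / ((d + 1 : ℕ) : ℝ) with ha
  set c := iteratedDeriv 2 g a with hc
  -- The quadratic coefficient is `c / 2`; losing `c / 4` to the remainder leaves `c / 4` as growth
  -- constant near the regular polygon.
  have hO := (isLittleO_taylor_two hg).def (c := c / 4) (by linarith)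
  rw [Metric.eventually_nhds_iff] at hO
  obtain ⟨r, hr, hO⟩ := hO
  have hnear : ∀ e ∈ arcSimplex (d + 1), (∀ i, |e i - a| < r) →
      c / 4 * ∑ i, (e i - a) ^ 2 ≤ ∑ i, g (e i) - ((d + 1 : ℕ) : ℝ) * g a := by
    intro e he hi
    have h1 := sum_taylor_two g a (sum_sub_mean_of_mem he)
    have h2 : ∑ i, (-(c / 4) * (e i - a) ^ 2) ≤ ∑ i, (g (a + (e i - a)) - g a -
        deriv g a * (e i - a) - iteratedDeriv 2 g a / 2 * (e i - a) ^ 2) := by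
      refine Finset.sum_le_sum fun i _ => ?_
      have := hO (y := e i - a) (by simpa using hi i)
      rw [Real.norm_eq_abs, abs_le, Real.norm_eq_abs, abs_of_nonneg (by positivity)] at this
      linarith [this.1]
    rw [h1, ← Finset.mul_sum] at h2
    linarith
  -- On this compact set of arc vectors far from the regular one, the excess has a positive minimum
  -- `η` by uniqueness, while the sum of squares is at most `B`; hence `η / B` serves as growth
  -- constant there.
  let S : Set (Fin (d + 1) → ℝ) := arcSimplex (d + 1) ∩ {e | ∃ i, r ≤ |e i - a|}
  have hS : IsCompact S := by
    refine (isCompact_arcSimplex _).inter_right ?_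
    have : {e : Fin (d + 1) → ℝ | ∃ i, r ≤ |e i - a|} = ⋃ i, {e | r ≤ |e i - a|} := by
      ext; simp
    rw [this]
    exact isClosed_iUnion_of_finite fun i => isClosed_le continuous_const (by fun_prop)
  have hbound : ∀ e ∈ arcSimplex (d + 1), ∑ i, (e i - a) ^ 2 ≤
      ((d + 1 : ℕ) : ℝ) * (2 * Real.pi) ^ 2 := by
    intro e he
    calc ∑ i, (e i - a) ^ 2 ≤ ∑ _i : Fin (d + 1), (2 * Real.pi) ^ 2 := by
          refine Finset.sum_le_sum fun i _ => sq_le_sq' ?_ ?_ <;>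
          linarith [(mem_Icc_of_mem_arcSimplex he i).1, (mem_Icc_of_mem_arcSimplex he i).2,
            (mem_Icc_of_mem_arcSimplex (const_mem_arcSimplex d) i).1,
            (mem_Icc_of_mem_arcSimplex (const_mem_arcSimplex d) i).2]
      _ = _ := by simp
  rcases S.eq_empty_or_nonempty with hSe | hSn
  · refine ⟨c / 4, by linarith, fun e he => hnear e he fun i => ?_⟩
    by_contra! hi
    exact (hSe ▸ (⟨he, i, hi⟩ : e ∈ S) : e ∈ (∅ : Set _)).elim
  · obtain ⟨e₀, he₀, hmin₀⟩ := hS.exists_isMinOn (f := fun e => ∑ i, g (e i)) hSn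
      (by fun_prop : Continuous fun e : Fin (d + 1) → ℝ => ∑ i, g (e i)).continuousOn
    have hη : 0 < ∑ i, g (e₀ i) - ((d + 1 : ℕ) : ℝ) * g a := by
      refine sub_pos.2 (lt_of_le_of_ne (hmin _ he₀.1).1 fun h => ?_)
      obtain ⟨i, hi⟩ := he₀.2
      rw [(hmin _ he₀.1).2 h.symm i] at hi
      simp at hi
      linarith
    set η := ∑ i, g (e₀ i) - ((d + 1 : ℕ) : ℝ) * g a with hηdef
    set B := ((d + 1 : ℕ) : ℝ) * (2 * Real.pi) ^ 2 with hB
    have hB0 : 0 < B := by positivity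
    refine ⟨min (c / 4) (η / B), lt_min (by linarith) (by positivity), fun e he => ?_⟩
    have hsq : 0 ≤ ∑ i, (e i - a) ^ 2 := Finset.sum_nonneg fun i _ => sq_nonneg _
    by_cases hi : ∀ i, |e i - a| < r
    · exact (mul_le_mul_of_nonneg_right (min_le_left _ _) hsq).trans (hnear e he hi)
    · push Not at hi
      have h1 : ∑ i, g (e₀ i) ≤ ∑ i, g (e i) := hmin₀ (⟨he, hi⟩ : e ∈ S)
      calc min (c / 4) (η / B) * ∑ i, (e i - a) ^ 2
          ≤ η / B * B := mul_le_mul (min_le_right _ _) (hbound e he) hsq (by positivity)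
        _ = η := by field_simp
        _ ≤ _ := by linarith

/-! ### Measurability -/

/-- The sorting permutation depends on `β`, so the preimage is split over the finitely many
permutations that sort `β`. Ties do no harm: all such permutations give the same sorted vector. -/
theorem measurable_orderedAngles {m : ℕ} (k : Fin (m + 1)) :
    Measurable fun β : Fin m → ℝ => orderedAngles β k := by
  induction k using Fin.lastCases with
  | last => simpa only [orderedAngles_last] using measurable_const
  | cast k =>
    simp only [orderedAngles_castSucc]
    intro A hA
    have : (fun β : Fin m → ℝ => β (Tuple.sort β k)) ⁻¹' A =
        ⋃ σ : Equiv.Perm (Fin m), {β | Monotone (β ∘ σ)} ∩ {β | β (σ k) ∈ A} := by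
      ext β
      simp only [mem_preimage, mem_iUnion, mem_inter_iff, mem_ofPred_eq]
      constructor
      · exact fun h => ⟨Tuple.sort β, Tuple.monotone_sort β, h⟩
      · rintro ⟨σ, hσ, h⟩
        have := congrFun (Tuple.comp_sort_eq_comp_iff_monotone.2 hσ) k
        simp only [Function.comp_apply] at this
        rwa [← this]
    rw [this]
    refine MeasurableSet.iUnion fun σ => MeasurableSet.inter ?_ (measurable_pi_apply (σ k) hA)
    have : {β : Fin m → ℝ | Monotone (β ∘ σ)} =
        ⋂ i, ⋂ j, ⋂ _ : i ≤ j, {β | β (σ i) ≤ β (σ j)} := by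
      ext β
      simp [Monotone]
    rw [this]
    exact MeasurableSet.iInter fun i => MeasurableSet.iInter fun j => MeasurableSet.iInter fun _ =>
      measurableSet_le (measurable_pi_apply _) (measurable_pi_apply _)

theorem measurable_gapSum {m : ℕ} {g : ℝ → ℝ} (hg : Measurable g) :
    Measurable (gapSum (m := m) g) := by
  unfold gapSum
  exact Finset.measurable_sum _ fun i _ =>
    hg.comp ((measurable_orderedAngles _).sub (measurable_orderedAngles _))

theorem measurable_centralAngle :
    Measurable fun zw : Circle × Circle => centralAngle zw.1 zw.2 := by
  have h : Measurable fun b : ℝ => toIcoMod Real.two_pi_pos 0 b := by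
    simp only [toIcoMod_eq_fract_mul]
    exact (measurable_fract.comp (measurable_id.div_const _)).mul_const _
  refine h.comp (Complex.measurable_arg.comp ?_)
  have h1 : Continuous fun zw : Circle × Circle => zw.2 / zw.1 := by fun_prop
  have h2 : Continuous fun z : Circle => (z : ℂ) := continuous_subtype_val
  exact (h2.comp h1).measurable

theorem measurable_kernel {m : ℕ} [NeZero m] {g : ℝ → ℝ} (hg : Measurable g) :
    Measurable (kernel (m := m) g) := by
  have h1 : ∀ i : Fin m, Measurable fun u : Fin m → Circle => centralAngle (u 0) (u i) := by
    intro i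
    have h0 : Measurable fun u : Fin m → Circle => (u 0, u i) := by fun_prop
    exact measurable_centralAngle.comp h0
  have h2 : Measurable fun (u : Fin m → Circle) (i : Fin m) => centralAngle (u 0) (u i) :=
    measurable_pi_lambda _ h1
  exact (measurable_gapSum hg).comp h2

/-! ### Almost minimal configurations are almost regular -/

theorem abs_orderedAngles_sub_le {d : ℕ} {β : Fin (d + 1) → ℝ} {a ρ : ℝ}
    (h0 : orderedAngles β 0 = 0) (h : ∀ i, |gap β i - a| ≤ ρ) (k : Fin (d + 2)) :
    |orderedAngles β k - (k : ℕ) * a| ≤ (k : ℕ) * ρ := by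
  induction k using Fin.induction with
  | zero => simp [h0]
  | succ i ih =>
    have h1 := h i
    rw [gap] at h1
    simp only [Fin.val_succ, Fin.val_castSucc] at ih ⊢
    push_cast
    rw [abs_le] at *
    constructor <;> linarith [h1.1, h1.2, ih.1, ih.2]

/-- The `(d + 1)`-th power sends all vertices of a regular polygon to the same point. Each sorted
angle is off by at most `(d + 1) ρ` after the errors of the arcs accumulate, and the power
multiplies this by `d + 1`. Powers make closeness independent of the order of the vertices, so it
can be chained across overlapping tuples. -/
theorem norm_pow_sub_pow_le_of_arcs {d : ℕ} {u : Fin (d + 1) → Circle} {ρ : ℝ}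
    (h : ∀ i, |arcs u i - 2 * Real.pi / ((d + 1 : ℕ) : ℝ)| ≤ ρ) (i : Fin (d + 1)) :
    dist (u i ^ (d + 1)) (u 0 ^ (d + 1)) ≤ ((d + 1 : ℕ) : ℝ) * (((d + 1 : ℕ) : ℝ) * ρ) := by
  set β : Fin (d + 1) → ℝ := fun i => centralAngle (u 0) (u i) with hβ
  have hρ : 0 ≤ ρ := (abs_nonneg _).trans (h 0)
  have h0 : orderedAngles β 0 = 0 :=
    orderedAngles_zero (fun i => (centralAngle_mem_Ico _ _).1) ⟨0, centralAngle_self _⟩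
  set j : Fin (d + 1) := (Tuple.sort β).symm i with hj
  have h1 := abs_orderedAngles_sub_le h0 h j.castSucc
  rw [orderedAngles_castSucc, hj, Equiv.apply_symm_apply, ← hj, Fin.val_castSucc] at h1
  have hui : u i = u 0 * Circle.exp (β i) := (mul_exp_centralAngle _ _).symm
  have hjm : ((j : ℕ) : ℝ) ≤ ((d + 1 : ℕ) : ℝ) := by exact_mod_cast j.is_lt.le
  set x := β i - ((j : ℕ) : ℝ) * (2 * Real.pi / ((d + 1 : ℕ) : ℝ)) with hx
  have hpow : u i ^ (d + 1) = u 0 ^ (d + 1) * Circle.exp (((d + 1 : ℕ) : ℝ) * x) := by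
    rw [hui, mul_pow, ← Circle.exp_natCast_mul]
    congr 1
    rw [Circle.exp_eq_exp]
    refine ⟨(j : ℕ), ?_⟩
    rw [hx]
    push_cast
    field_simp
    ring
  have hdist : dist (u i ^ (d + 1)) (u 0 ^ (d + 1)) =
      ‖Complex.exp (Complex.I * ((((d + 1 : ℕ) : ℝ) * x : ℝ) : ℂ)) - 1‖ := by
    have hd : dist (u i ^ (d + 1)) (u 0 ^ (d + 1)) =
        dist ((u i ^ (d + 1) : Circle) : ℂ) ((u 0 ^ (d + 1) : Circle) : ℂ) := rfl
    rw [hd, dist_eq_norm, hpow]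
    have hn : ‖((u 0 ^ (d + 1) : Circle) : ℂ)‖ = 1 := Circle.norm_coe _
    have : (((u 0 ^ (d + 1) * Circle.exp (((d + 1 : ℕ) : ℝ) * x) : Circle)) : ℂ) -
        ((u 0 ^ (d + 1) : Circle) : ℂ) = ((u 0 ^ (d + 1) : Circle) : ℂ) *
        (Complex.exp (Complex.I * ((((d + 1 : ℕ) : ℝ) * x : ℝ) : ℂ)) - 1) := by
      rw [Circle.coe_mul, Circle.coe_exp, mul_comm Complex.I]
      ring
    rw [this, norm_mul, hn, one_mul]
  rw [hdist]
  refine (Real.norm_exp_I_mul_ofReal_sub_one_le).trans ?_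
  rw [Real.norm_eq_abs, abs_mul, abs_of_nonneg (by positivity : (0 : ℝ) ≤ ((d + 1 : ℕ) : ℝ))]
  gcongr
  exact h1.trans (by gcongr)

/-- If the kernel is within `δ²` of its minimum, then the `m`-th powers of the points are within a
constant multiple of `δ` of each other. -/
theorem exists_dist_pow_le {d : ℕ} {g : ℝ → ℝ} (hgc : Continuous g)
    (hg : ContDiffAt ℝ 2 g (2 * Real.pi / ((d + 1 : ℕ) : ℝ)))
    (hpos : 0 < iteratedDeriv 2 g (2 * Real.pi / ((d + 1 : ℕ) : ℝ)))
    (hmin : RegularPolygonUniqueMin (d + 1) g) :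
    ∃ C : ℝ, 0 < C ∧ ∀ δ : ℝ, 0 ≤ δ → ∀ u : Fin (d + 1) → Circle,
      kernel g u ≤ ((d + 1 : ℕ) : ℝ) * g (2 * Real.pi / ((d + 1 : ℕ) : ℝ)) + δ ^ 2 →
      ∀ i j, dist (u i ^ (d + 1)) (u j ^ (d + 1)) ≤ C * δ := by
  obtain ⟨κ, hκ, hgrow⟩ := exists_quadratic_growth hgc hg hpos hmin
  set a := 2 * Real.pi / ((d + 1 : ℕ) : ℝ) with ha
  -- The factor `2` pays for comparing both points with `u 0`; the factor `κ^(-1/2)` converts an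
  -- excess `δ²` into a bound on each arc.
  refine ⟨2 * (((d + 1 : ℕ) : ℝ) * (((d + 1 : ℕ) : ℝ) * (Real.sqrt κ)⁻¹)), by positivity,
    fun δ hδ u hu i j => ?_⟩
  have harc (k) : |arcs u k - a| ≤ (Real.sqrt κ)⁻¹ * δ := by
    have h1 := hgrow _ (arcs_mem_arcSimplex u)
    rw [← kernel_eq_sum_arcs] at h1
    have h2 : (arcs u k - a) ^ 2 ≤ ∑ i, (arcs u i - a) ^ 2 :=
      Finset.single_le_sum (f := fun i => (arcs u i - a) ^ 2) (fun i _ => sq_nonneg _)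
        (Finset.mem_univ k)
    refine abs_le_of_sq_le_sq ?_ (by positivity)
    rw [mul_pow, inv_pow, Real.sq_sqrt hκ.le, ← div_eq_inv_mul, le_div_iff₀ hκ]
    nlinarith
  have h1 := norm_pow_sub_pow_le_of_arcs harc i
  have h2 := norm_pow_sub_pow_le_of_arcs harc j
  have h3 := dist_triangle_right (u i ^ (d + 1)) (u j ^ (d + 1)) (u 0 ^ (d + 1))
  calc _ ≤ _ := h3
    _ ≤ _ := add_le_add h1 h2
    _ = _ := by ring

/-! ### Poisson approximation for dissociated events -/

section Poisson

variable {Ω ι : Type*}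

theorem prod_one_sub_mem_Icc {s : Finset ι} {x : ℝ} (hx : x ∈ Icc (0 : ℝ) 1) {X : ι → ℝ}
    (hX : ∀ i, X i ∈ Icc (0 : ℝ) 1) : ∏ i ∈ s, (1 - x * X i) ∈ Icc (0 : ℝ) 1 := by
  have h (i) : 0 ≤ 1 - x * X i ∧ 1 - x * X i ≤ 1 :=
    ⟨sub_nonneg.2 (mul_le_one₀ hx.2 (hX i).1 (hX i).2), by
      have := mul_nonneg hx.1 (hX i).1; linarith⟩
  exact ⟨Finset.prod_nonneg fun i _ => (h i).1, Finset.prod_le_one (fun i _ => (h i).1)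
    fun i _ => (h i).2⟩

theorem one_sub_sum_le_prod_one_sub_mul {s : Finset ι} {x : ℝ} (hx : x ∈ Icc (0 : ℝ) 1) {X : ι → ℝ}
    (hX : ∀ i, X i ∈ Icc (0 : ℝ) 1) : 1 - ∑ i ∈ s, X i ≤ ∏ i ∈ s, (1 - x * X i) := by
  classical
  induction s using Finset.induction_on with
  | empty => simp
  | insert a s ha ih =>
    rw [Finset.sum_insert ha, Finset.prod_insert ha]
    have h1 := prod_one_sub_mem_Icc (s := s) hx hX
    have h2 : x * X a ≤ X a := mul_le_of_le_one_left (hX a).1 hx.2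
    have h3 : 0 ≤ x * X a := mul_nonneg hx.1 (hX a).1
    nlinarith [h1.1, h1.2]

variable [MeasurableSpace Ω] {μ : Measure Ω} [IsProbabilityMeasure μ] [Fintype ι]

/-- The probability that none of a finite family of dissociated events occurs is close to the
Poisson probability, with the usual first and second order error terms. -/
theorem abs_prob_none_sub_exp_le [DecidableEq ι] {A : ι → Set Ω} (hA : ∀ i, MeasurableSet (A i))
    {N : ι → Finset ι} (hN : ∀ i, i ∈ N i)
    (hind : ∀ i, IndepFun ((A i).indicator (1 : Ω → ℝ))
      (fun ω (j : {j // j ∉ N i}) => (A j).indicator (1 : Ω → ℝ) ω) μ) :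
    |μ.real {ω | ∀ i, ω ∉ A i} - Real.exp (-∑ i, μ.real (A i))| ≤
      ∑ i, ∑ j ∈ N i, μ.real (A i) * μ.real (A j) +
        ∑ i, ∑ j ∈ (N i).erase i, μ.real (A i ∩ A j) := by
  let X : ι → Ω → ℝ := fun i => (A i).indicator 1
  have hXm (i) : Measurable (X i) := measurable_one.indicator (hA i)
  have hX (ω) (i) : X i ω ∈ Icc (0 : ℝ) 1 := by
    by_cases h : ω ∈ A i <;> simp [X, h]
  have hXint (i) : ∫ ω, X i ω ∂μ = μ.real (A i) := integral_indicator_one (hA i)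
  let P : Finset ι → ℝ → Ω → ℝ := fun s x ω => ∏ i ∈ s, (1 - x * X i ω)
  have hPm (s x) : Measurable (P s x) :=
    Finset.measurable_prod _ fun i _ => measurable_const.sub ((hXm i).const_mul x)
  have hP {x : ℝ} (hx : x ∈ Icc (0 : ℝ) 1) (s ω) : P s x ω ∈ Icc (0 : ℝ) 1 :=
    prod_one_sub_mem_Icc hx (hX ω)
  have hint {f : Ω → ℝ} (hf : Measurable f) (h01 : ∀ ω, f ω ∈ Icc (0 : ℝ) 1) : Integrable f μ :=
    Integrable.of_bound hf.aestronglyMeasurable 1 (Eventually.of_forall fun ω => by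
      rw [Real.norm_eq_abs, abs_of_nonneg (h01 ω).1]; exact (h01 ω).2)
  have hmul01 {a b : ℝ} (ha : a ∈ Icc (0 : ℝ) 1) (hb : b ∈ Icc (0 : ℝ) 1) :
      a * b ∈ Icc (0 : ℝ) 1 := ⟨mul_nonneg ha.1 hb.1, mul_le_one₀ ha.2 hb.1 hb.2⟩
  -- `G` interpolates between `1` at `x = 0` and the probability that no event occurs at `x = 1`. In
  -- the Poisson case it would solve `G' = -Λ G`; the proof bounds the defect in this equation.
  let G : ℝ → ℝ := fun x => ∫ ω, P Finset.univ x ω ∂μ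
  let D : ℝ → ℝ := fun x => -∑ i, ∫ ω, X i ω * P (Finset.univ.erase i) x ω ∂μ
  have hXPint {x : ℝ} (hx : x ∈ Icc (0 : ℝ) 1) (i s) : Integrable (fun ω => X i ω * P s x ω) μ :=
    hint ((hXm i).mul (hPm _ _)) fun ω => hmul01 (hX ω i) (hP hx s ω)
  have hderiv {x : ℝ} (hx : x ∈ Icc (0 : ℝ) 1) : HasDerivAt G (D x) x := by
    let F' : ℝ → Ω → ℝ := fun x ω => ∑ i, P (Finset.univ.erase i) x ω • (-X i ω)
    have hb (y : ℝ) (hy : y ∈ Metric.ball x 1) (s : Finset ι) (ω : Ω) :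
        |P s y ω| ≤ 3 ^ Fintype.card ι := by
      rw [Finset.abs_prod]
      calc ∏ i ∈ s, |1 - y * X i ω| ≤ ∏ i ∈ s, (3 : ℝ) := by
            refine Finset.prod_le_prod (fun _ _ => abs_nonneg _) fun i _ => ?_
            have hy' : |y| ≤ 2 := by
              rw [Metric.mem_ball, Real.dist_eq, abs_lt] at hy
              rw [abs_le]; constructor <;> linarith [hy.1, hy.2, hx.1, hx.2]
            have : |y * X i ω| ≤ 2 := by
              rw [abs_mul, abs_of_nonneg (hX ω i).1]
              exact (mul_le_of_le_one_right (abs_nonneg _) (hX ω i).2).trans hy'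
            rw [abs_le] at this ⊢
            constructor <;> linarith [this.1, this.2]
        _ = 3 ^ s.card := by simp
        _ ≤ _ := pow_le_pow_right₀ (by norm_num) s.card_le_univ
    have h := (hasDerivAt_integral_of_dominated_loc_of_deriv_le (μ := μ) (F := P Finset.univ)
      (F' := F') (x₀ := x) (s := Metric.ball x 1)
      (bound := fun _ => ∑ _i : ι, (3 : ℝ) ^ Fintype.card ι) (Metric.ball_mem_nhds _ one_pos)
      (Eventually.of_forall fun y => (hPm _ y).aestronglyMeasurable)
      (hint (hPm _ _) (hP hx _))
      (Finset.measurable_sum _ fun i _ => (hPm _ _).mul (hXm i).neg).aestronglyMeasurable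
      (Eventually.of_forall fun ω y hy => ?_) (integrable_const _)
      (Eventually.of_forall fun ω y hy => ?_)).2
    · have : ∫ ω, F' x ω ∂μ = D x := by
        simp only [F', D, smul_eq_mul, mul_neg]
        rw [integral_finsetSum _ fun i _ => ?_, ← Finset.sum_neg_distrib]
        · refine Finset.sum_congr rfl fun i _ => ?_
          rw [integral_neg]
          congr 2
          funext ω
          ring
        · refine ((hXPint hx i (Finset.univ.erase i)).neg).congr (Eventually.of_forall fun ω => ?_)
          simp only [Pi.neg_apply]
          ring
      rwa [this] at h
    · refine (norm_sum_le _ _).trans (Finset.sum_le_sum fun i _ => ?_)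
      rw [smul_eq_mul, Real.norm_eq_abs, abs_mul, abs_neg, abs_of_nonneg (hX ω i).1]
      exact (mul_le_of_le_one_right (abs_nonneg _) (hX ω i).2).trans (hb y hy _ ω)
    · refine HasDerivAt.fun_finsetProd fun i _ => ?_
      simpa using ((hasDerivAt_id y).mul_const (X i ω)).const_sub 1
  set Λ := ∑ i, μ.real (A i) with hΛ
  set b := ∑ i, ∑ j ∈ N i, μ.real (A i) * μ.real (A j) +
        ∑ i, ∑ j ∈ (N i).erase i, μ.real (A i ∩ A j) with hb
  have hb0 : 0 ≤ b := by positivity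
  -- Both `E[X i · P (univ.erase i)]` and `P(A i) · G` are compared with `P(A i) · E[P S]`, where
  -- `S` collects the indices outside `N i` and independence applies. Reinstating the omitted
  -- factors costs at most `∑ P(A i ∩ A j)` in the first case and `P(A i) ∑ P(A j)` in the second.
  have hmain {x : ℝ} (hx : x ∈ Icc (0 : ℝ) 1) : |D x + Λ * G x| ≤ b := by
    have hterm (i : ι) : |μ.real (A i) * G x - ∫ ω, X i ω * P (Finset.univ.erase i) x ω ∂μ| ≤
        ∑ j ∈ N i, μ.real (A i) * μ.real (A j) + ∑ j ∈ (N i).erase i, μ.real (A i ∩ A j) := by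
      set S : Finset ι := Finset.univ \ N i with hS
      have hsplit (T : Finset ι) (hT : T ⊆ N i) (ω : Ω) :
          P S x ω - ∑ j ∈ T, X j ω ≤ P (S ∪ T) x ω ∧ P (S ∪ T) x ω ≤ P S x ω := by
        have hdisj : Disjoint S T := by
          rw [hS]; exact Finset.disjoint_of_subset_right hT Finset.sdiff_disjoint
        have heq : P (S ∪ T) x ω = P S x ω * P T x ω := Finset.prod_union hdisj
        have h1 := hP hx S ω
        have h2 := hP hx T ω
        have h3 : 1 - ∑ j ∈ T, X j ω ≤ P T x ω := one_sub_sum_le_prod_one_sub_mul hx (hX ω)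
        have h4 : 0 ≤ ∑ j ∈ T, X j ω := Finset.sum_nonneg fun j _ => (hX ω j).1
        rw [heq]
        constructor <;> nlinarith [h1.1, h1.2, h2.1, h2.2]
      have hU : S ∪ N i = Finset.univ := by rw [hS]; exact Finset.sdiff_union_of_subset (Finset.subset_univ _)
      have hE : S ∪ (N i).erase i = Finset.univ.erase i := by
        ext j
        simp only [hS, Finset.mem_union, Finset.mem_sdiff, Finset.mem_univ, true_and,
          Finset.mem_erase, and_true]
        constructor
        · rintro (h | h)
          · rintro rfl; exact h (hN j)
          · exact h.1
        · intro h; by_cases hj : j ∈ N i <;> tauto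
      have hSind : ∫ ω, X i ω * P S x ω ∂μ = μ.real (A i) * ∫ ω, P S x ω ∂μ := by
        let φ : ({j // j ∉ N i} → ℝ) → ℝ := fun v => ∏ j, (1 - x * v j)
        have hφ : Measurable φ := by fun_prop
        have hc := (hind i).comp measurable_id hφ
        have hPφ : P S x = φ ∘ fun ω (j : {j // j ∉ N i}) => (A j).indicator (1 : Ω → ℝ) ω := by
          funext ω
          simp only [P, φ, Function.comp_apply, X]
          exact (Finset.prod_subtype S (p := fun j => j ∉ N i) (by simp [hS])
            (fun j => 1 - x * (A j).indicator (1 : Ω → ℝ) ω))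
        have h := IndepFun.integral_fun_mul_eq_mul_integral hc
          (measurable_id.comp (hXm i)).aestronglyMeasurable
          (by rw [← hPφ]; exact (hPm S x).aestronglyMeasurable)
        rw [← hPφ] at h
        rw [← hXint]
        exact h
      have hE1 := hXPint hx i S
      have hE2 := hXPint hx i (Finset.univ.erase i)
      have hXX (j) : ∫ ω, X i ω * X j ω ∂μ = μ.real (A i ∩ A j) := by
        rw [← integral_indicator_one ((hA i).inter (hA j))]
        congr 1
        funext ω
        rw [Set.inter_indicator_one]
        rfl
      have hXXint (j) : Integrable (fun ω => X i ω * X j ω) μ :=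
        hint ((hXm i).mul (hXm j)) fun ω => hmul01 (hX ω i) (hX ω j)
      have hXi (j) : Integrable (X j) μ := hint (hXm j) fun ω => hX ω j
      have h1 : ∫ ω, X i ω * P (Finset.univ.erase i) x ω ∂μ ≤ ∫ ω, X i ω * P S x ω ∂μ := by
        refine integral_mono hE2 hE1 fun ω => ?_
        have := (hsplit _ (Finset.erase_subset i (N i)) ω).2
        rw [hE] at this
        exact mul_le_mul_of_nonneg_left this (hX ω i).1
      have h2 : ∫ ω, X i ω * P S x ω ∂μ - ∑ j ∈ (N i).erase i, μ.real (A i ∩ A j) ≤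
          ∫ ω, X i ω * P (Finset.univ.erase i) x ω ∂μ := by
        simp only [← hXX]
        rw [← integral_finsetSum _ fun j _ => hXXint j,
          ← integral_sub hE1 (integrable_finsetSum _ fun j _ => hXXint j)]
        refine integral_mono (hE1.sub (integrable_finsetSum _ fun j _ => hXXint j)) hE2 fun ω => ?_
        have := (hsplit _ (Finset.erase_subset i (N i)) ω).1
        rw [hE] at this
        have := mul_le_mul_of_nonneg_left this (hX ω i).1
        rw [mul_sub, Finset.mul_sum] at this
        exact this
      have h3 : G x ≤ ∫ ω, P S x ω ∂μ := by
        refine integral_mono (hint (hPm _ _) (hP hx _)) (hint (hPm _ _) (hP hx _)) fun ω => ?_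
        have := (hsplit _ subset_rfl ω).2
        rwa [hU] at this
      have h4 : ∫ ω, P S x ω ∂μ - ∑ j ∈ N i, μ.real (A j) ≤ G x := by
        simp only [← hXint]
        rw [← integral_finsetSum _ fun j _ => hXi j,
          ← integral_sub (hint (hPm _ _) (hP hx _)) (integrable_finsetSum _ fun j _ => hXi j)]
        refine integral_mono ((hint (hPm _ _) (hP hx _)).sub
          (integrable_finsetSum _ fun j _ => hXi j)) (hint (hPm _ _) (hP hx _)) fun ω => ?_
        have := (hsplit _ subset_rfl ω).1
        rwa [hU] at this
      rw [hSind] at h1 h2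
      have hp : 0 ≤ μ.real (A i) := measureReal_nonneg
      have h5 := mul_le_mul_of_nonneg_left h3 hp
      have h6 := mul_le_mul_of_nonneg_left h4 hp
      rw [mul_sub] at h6
      rw [← Finset.mul_sum, abs_le]
      have h7 : 0 ≤ μ.real (A i) * ∑ j ∈ N i, μ.real (A j) := by positivity
      have h8 : 0 ≤ ∑ j ∈ (N i).erase i, μ.real (A i ∩ A j) := by positivity
      constructor <;> linarith
    have : D x + Λ * G x =
        ∑ i, (μ.real (A i) * G x - ∫ ω, X i ω * P (Finset.univ.erase i) x ω ∂μ) := by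
      rw [Finset.sum_sub_distrib, ← Finset.sum_mul]
      simp only [D, hΛ]
      ring
    rw [this, hb, ← Finset.sum_add_distrib]
    exact (Finset.abs_sum_le_sum_abs _ _).trans (Finset.sum_le_sum fun i _ => hterm i)
  have hΛ0 : 0 ≤ Λ := by positivity
  -- Integrating factor: the derivative of `exp (Λ x) G x` is `exp (Λ x)` times the defect, hence at
  -- most `exp Λ · b`. The factor `exp Λ` cancels when the increment over `[0, 1]` is divided by it.
  have hmv := Convex.norm_image_sub_le_of_norm_hasDerivWithin_le
    (f := fun x => Real.exp (Λ * x) * G x)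
    (f' := fun x => Real.exp (Λ * x) * (D x + Λ * G x)) (s := Icc (0 : ℝ) 1)
    (C := Real.exp Λ * b) (x := 0) (y := 1) (fun x hx => by
      have h1 : HasDerivAt (fun x => Real.exp (Λ * x)) (Real.exp (Λ * x) * (Λ * 1)) x :=
        ((hasDerivAt_id x).const_mul Λ).exp
      have h2 := h1.mul (hderiv hx)
      refine (h2.congr_deriv ?_).hasDerivWithinAt
      ring) (fun x hx => by
      rw [norm_mul, Real.norm_eq_abs, Real.norm_eq_abs, Real.abs_exp]
      refine mul_le_mul (Real.exp_le_exp.2 (mul_le_of_le_one_right hΛ0 hx.2)) (hmain hx)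
        (abs_nonneg _) (Real.exp_pos _).le)
    (convex_Icc 0 1) (by simp) (by simp)
  have hG0 : G 0 = 1 := by simp [G, P]
  have hG1 : G 1 = μ.real {ω | ∀ i, ω ∉ A i} := by
    have hset : {ω | ∀ i, ω ∉ A i} = ⋂ i, (A i)ᶜ := by ext; simp
    have hm : MeasurableSet {ω | ∀ i, ω ∉ A i} := by
      rw [hset]; exact MeasurableSet.iInter fun i => (hA i).compl
    rw [← integral_indicator_one hm]
    simp only [G]
    congr 1
    funext ω
    by_cases h : ∀ i, ω ∉ A i
    · rw [indicator_of_mem (by exact h)]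
      simp [P, X, h]
    · rw [indicator_of_notMem (by exact h)]
      push Not at h
      obtain ⟨i, hi⟩ := h
      exact Finset.prod_eq_zero (Finset.mem_univ i) (by simp [X, hi])
  simp only [hG0, hG1, mul_one, mul_zero, Real.exp_zero, sub_zero, norm_one] at hmv
  rw [Real.norm_eq_abs] at hmv
  have hfac : Real.exp Λ * μ.real {ω | ∀ i, ω ∉ A i} - 1 =
      Real.exp Λ * (μ.real {ω | ∀ i, ω ∉ A i} - Real.exp (-Λ)) := by
    rw [mul_sub, ← Real.exp_add, add_neg_cancel, Real.exp_zero]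
  rw [hfac, abs_mul, Real.abs_exp] at hmv
  exact le_of_mul_le_mul_left hmv (Real.exp_pos _)

end Poisson

/-! ### Laws of the random points -/

theorem setLIntegral_add_left_of_periodic {φ : ℝ → ENNReal}
    (hφ : Function.Periodic φ (2 * Real.pi)) (x : ℝ) :
    ∫⁻ s in Ico 0 (2 * Real.pi), φ (x + s) = ∫⁻ s in Ico 0 (2 * Real.pi), φ s := by
  rw [setLIntegral_congr Ico_ae_eq_Ioc, setLIntegral_congr (Ico_ae_eq_Ioc (a := (0 : ℝ)))]
  have h := (measurePreserving_add_left (volume : Measure ℝ) x).setLIntegral_comp_preimage_emb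
    (MeasurableEquiv.addLeft x).measurableEmbedding φ (Ioc x (x + 2 * Real.pi))
  have hpre : (fun s => x + s) ⁻¹' Ioc x (x + 2 * Real.pi) = Ioc 0 (2 * Real.pi) := by
    simp
  rw [hpre] at h
  rw [h]
  have : VAddInvariantMeasure (AddSubgroup.zmultiples (2 * Real.pi)) ℝ volume :=
    ⟨fun c s _ => measure_preimage_add _ _ _⟩
  have h2 := (isAddFundamentalDomain_Ioc Real.two_pi_pos x).setLIntegral_eq
    (isAddFundamentalDomain_Ioc Real.two_pi_pos 0) φ hφ.map_vadd_zmultiples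
  rwa [zero_add] at h2

/-- The measure on `[0, 2π)` with density `q`. -/
def angleLaw (q : ℝ → ℝ) : Measure ℝ :=
  (volume.restrict (Ico 0 (2 * Real.pi))).withDensity fun x => ENNReal.ofReal (q x)

/-- Periodicity lets the circle be cut at any point `x`. It is used with `x` the angle of the first
point, so that `s` is the central angle measured from there. -/
theorem circleLaw_eq_map_add {p : ℝ → ℝ} (hper : Function.Periodic p (2 * Real.pi)) (x : ℝ) :
    circleLaw p = (angleLaw fun s => p (x + s)).map fun s => Circle.exp (x + s) := by
  ext B hB
  have hm0 : Measurable fun s : ℝ => Circle.exp s := Circle.exp.continuous.measurable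
  have hm : Measurable fun s => Circle.exp (x + s) := hm0.comp (measurable_const_add x)
  rw [circleLaw, angleLaw, Measure.map_apply hm0 hB, Measure.map_apply hm hB,
    withDensity_apply _ (hm0 hB), withDensity_apply _ (hm hB),
    ← lintegral_indicator (hm0 hB), ← lintegral_indicator (hm hB)]
  refine (setLIntegral_add_left_of_periodic (φ := indicator (Circle.exp ⁻¹' B)
    fun s => ENNReal.ofReal (p s)) (fun s => ?_) x).symm
  have : s + 2 * Real.pi ∈ Circle.exp ⁻¹' B ↔ s ∈ Circle.exp ⁻¹' B := by
    simp only [mem_preimage, Circle.exp_add_two_pi]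
  by_cases hs : s ∈ Circle.exp ⁻¹' B
  · rw [indicator_of_mem hs, indicator_of_mem (this.2 hs), hper]
  · rw [indicator_of_notMem hs, indicator_of_notMem (fun h => hs (this.1 h))]

theorem exists_bound_of_periodic {p : ℝ → ℝ} (hp : Continuous p)
    (hper : Function.Periodic p (2 * Real.pi)) : ∃ M : ℝ, 0 < M ∧ ∀ x, p x ≤ M := by
  obtain ⟨M, hM⟩ := (isCompact_Icc (a := (0 : ℝ)) (b := 2 * Real.pi)).bddAbove_image hp.continuousOn
  refine ⟨max M 1, lt_max_of_lt_right one_pos, fun x => ?_⟩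
  obtain ⟨y, hy, hxy⟩ := hper.exists_mem_Ico₀ Real.two_pi_pos x
  rw [hxy]
  exact (hM (mem_image_of_mem p (Ico_subset_Icc_self hy))).trans (le_max_left _ _)

/-- The norm is `2 |sin (x/2)|`. Subtracting the nearest multiple of `2π` from `x` brings the
half-angle into `[-π/2, π/2]`, where Jordan's inequality applies. -/
theorem norm_exp_sub_one_ge (x : ℝ) :
    ∃ l : ℤ, 2 / Real.pi * |x - l * (2 * Real.pi)| ≤ ‖Complex.exp (Complex.I * x) - 1‖ := by
  have hpi := Real.pi_pos
  refine ⟨round (x / (2 * Real.pi)), ?_⟩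
  set l := round (x / (2 * Real.pi)) with hl
  have h1 : |x / (2 * Real.pi) - l| ≤ 1 / 2 := abs_sub_round _
  have h2 : |x / 2 - l * Real.pi| ≤ Real.pi / 2 := by
    have : x / 2 - l * Real.pi = Real.pi * (x / (2 * Real.pi) - l) := by field_simp
    rw [this, abs_mul, abs_of_pos hpi]
    nlinarith
  have h3 := Real.mul_abs_le_abs_sin h2
  rw [Real.sin_sub_int_mul_pi, abs_mul, abs_zpow, abs_neg, abs_one, one_zpow, one_mul] at h3
  rw [Complex.norm_exp_I_mul_ofReal_sub_one, norm_mul, Real.norm_eq_abs, Real.norm_eq_abs, abs_two]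
  have h4 : |x - l * (2 * Real.pi)| = 2 * |x / 2 - l * Real.pi| := by
    rw [← abs_two (α := ℝ), ← abs_mul, abs_two]
    congr 1
    ring
  rw [h4]
  linarith

/-- The condition confines `w` to short arcs around the points `z · exp (2πil/m)`, each of length
`O(δ)`, and the density is bounded. -/
theorem exists_circleLaw_dist_pow_le {p : ℝ → ℝ} (hp : Continuous p)
    (hper : Function.Periodic p (2 * Real.pi)) {m : ℕ} (hm : 0 < m) :
    ∃ C : ℝ, 0 < C ∧ ∀ (z : Circle) (δ : ℝ), 0 ≤ δ →
      circleLaw p {w | dist (w ^ m) (z ^ m) ≤ δ} ≤ ENNReal.ofReal (C * δ) := by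
  obtain ⟨M, hM, hpM⟩ := exists_bound_of_periodic hp hper
  have hpi := Real.pi_pos
  have hmR : (1 : ℝ) ≤ m := by exact_mod_cast hm
  refine ⟨M * ((m + 1) * Real.pi), by positivity, fun z δ hδ => ?_⟩
  obtain ⟨x, rfl⟩ := Circle.exp_surjective z
  rw [circleLaw_eq_map_add hper x, Measure.map_apply]
  rotate_left
  · exact (Circle.exp.continuous.comp (continuous_const.add continuous_id)).measurable
  · exact (isClosed_le (by fun_prop) continuous_const).measurableSet
  have hdist (s : ℝ) : dist (Circle.exp (x + s) ^ m) (Circle.exp x ^ m) =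
      ‖Complex.exp (Complex.I * ((m * s : ℝ) : ℂ)) - 1‖ := by
    have hd : dist (Circle.exp (x + s) ^ m) (Circle.exp x ^ m) =
        dist ((Circle.exp (x + s) ^ m : Circle) : ℂ) ((Circle.exp x ^ m : Circle) : ℂ) := rfl
    have hn : ‖((Circle.exp x ^ m : Circle) : ℂ)‖ = 1 := Circle.norm_coe _
    have : ((Circle.exp (x + s) ^ m : Circle) : ℂ) - ((Circle.exp x ^ m : Circle) : ℂ) =
        ((Circle.exp x ^ m : Circle) : ℂ) *
          (Complex.exp (Complex.I * ((m * s : ℝ) : ℂ)) - 1) := by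
      rw [Circle.exp_add, mul_pow, ← Circle.exp_natCast_mul s m, Circle.coe_mul,
        Circle.coe_exp, mul_comm Complex.I]
      ring
    rw [hd, dist_eq_norm, this, norm_mul, hn, one_mul]
  -- There are `m + 1` intervals rather than `m`, because the arc around `z` meets both ends of `[0,
  -- 2π)`.
  have hsub : (fun s => Circle.exp (x + s)) ⁻¹' {w | dist (w ^ m) (Circle.exp x ^ m) ≤ δ} ∩
      Ico 0 (2 * Real.pi) ⊆
      ⋃ l ∈ Finset.range (m + 1), Metric.closedBall ((l : ℝ) * (2 * Real.pi) / m) (Real.pi / 2 * δ) := by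
    rintro s ⟨hs, hs0, hs1⟩
    simp only [mem_preimage, mem_ofPred_eq, hdist] at hs
    obtain ⟨l, hl⟩ := norm_exp_sub_one_ge (m * s)
    have h1 : 2 / Real.pi * |m * s - l * (2 * Real.pi)| ≤ δ := hl.trans hs
    have h1' : |m * s - l * (2 * Real.pi)| ≤ Real.pi / 2 * δ := by
      have : |m * s - l * (2 * Real.pi)| =
        Real.pi / 2 * (2 / Real.pi * |m * s - l * (2 * Real.pi)|) := by field_simp
      rw [this]; gcongr
    have hδ4 : ∃ k ∈ Finset.range (m + 1), |m * s - (k : ℕ) * (2 * Real.pi)| ≤ Real.pi / 2 * δ := by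
      -- Since `m * s` lies in `[0, 2πm]`, clamping the integer `l` to `[0, m]` can only reduce the
      -- distance.
      rcases lt_trichotomy l 0 with hl0 | hl0 | hl0
      · refine ⟨0, by simp, h1'.trans' ?_⟩
        have : (l : ℝ) ≤ -1 := by exact_mod_cast (by omega : l ≤ -1)
        have : 0 ≤ m * s := by positivity
        rw [Nat.cast_zero, zero_mul, sub_zero, abs_of_nonneg this,
          abs_of_nonneg (by nlinarith)]
        nlinarith
      · exact ⟨0, by simp, by simpa [hl0] using h1'⟩
      · by_cases hlm : l ≤ m
        · refine ⟨l.toNat, by simp; omega, ?_⟩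
          have : ((l.toNat : ℕ) : ℝ) = l := by exact_mod_cast Int.toNat_of_nonneg hl0.le
          rwa [this]
        · refine ⟨m, by simp, h1'.trans' ?_⟩
          have h5 : (m : ℝ) ≤ l := by exact_mod_cast (by omega : (m : ℤ) ≤ l)
          have h6 : m * s ≤ m * (2 * Real.pi) := by gcongr
          have h7 : m * (2 * Real.pi) ≤ l * (2 * Real.pi) := by gcongr
          rw [abs_of_nonpos (by linarith), abs_of_nonpos (by linarith)]
          linarith
    obtain ⟨k, hk, hk'⟩ := hδ4
    simp only [mem_iUnion]
    refine ⟨k, hk, ?_⟩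
    rw [Metric.mem_closedBall, Real.dist_eq]
    have : s - k * (2 * Real.pi) / m = (m * s - k * (2 * Real.pi)) / m := by field_simp
    rw [this, abs_div, abs_of_pos (by linarith : (0 : ℝ) < m)]
    exact (div_le_self (abs_nonneg _) hmR).trans hk'
  have hmeas : MeasurableSet ((fun s => Circle.exp (x + s)) ⁻¹'
      {w | dist (w ^ m) (Circle.exp x ^ m) ≤ δ}) := by
    refine (Circle.exp.continuous.comp (continuous_const.add continuous_id)).measurable ?_
    exact (isClosed_le (by fun_prop) continuous_const).measurableSet
  rw [angleLaw, withDensity_apply _ hmeas, Measure.restrict_restrict hmeas]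
  calc ∫⁻ s in _, ENNReal.ofReal (p (x + s))
      ≤ ∫⁻ s in _, ENNReal.ofReal M :=
        lintegral_mono fun s => ENNReal.ofReal_le_ofReal (hpM _)
    _ = ENNReal.ofReal M * volume _ := setLIntegral_const _ _
    _ ≤ ENNReal.ofReal M * (∑ l ∈ Finset.range (m + 1),
          volume (Metric.closedBall ((l : ℝ) * (2 * Real.pi) / m) (Real.pi / 2 * δ))) := by
        gcongr
        exact (measure_mono hsub).trans (measure_biUnion_finset_le _ _)
    _ = ENNReal.ofReal (M * ((m + 1) * Real.pi) * δ) := by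
        simp only [Real.volume_closedBall, Finset.sum_const, Finset.card_range, nsmul_eq_mul]
        rw [← ENNReal.ofReal_natCast, ← ENNReal.ofReal_mul (by positivity),
          ← ENNReal.ofReal_mul hM.le]
        congr 1
        push_cast
        ring

section Tuples

variable {Ω : Type*} [MeasurableSpace Ω] {μ : Measure Ω} [IsProbabilityMeasure μ]

theorem map_tuple_eq_pi {α ι κ : Type*} [MeasurableSpace α] [Fintype κ] {U : ι → Ω → α}
    (hU : ∀ i, Measurable (U i)) (hind : iIndepFun U μ) {ν : Measure α}
    (hlaw : ∀ i, μ.map (U i) = ν) {J : κ → ι} (hJ : Function.Injective J) :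
    μ.map (fun ω k => U (J k) ω) = Measure.pi fun _ => ν := by
  have h := (iIndepFun_iff_map_fun_eq_pi_map (fun k => (hU (J k)).aemeasurable)).1
    (hind.precomp hJ)
  simpa only [hlaw] using h

/-- Points that are all close to the same random point, up to a relation with small sections. -/
theorem prob_forall_mem_le {α ι : Type*} [MeasurableSpace α] [DecidableEq ι] {U : ι → Ω → α}
    (hU : ∀ i, Measurable (U i)) (hind : iIndepFun U μ) {ν : Measure α} [IsProbabilityMeasure ν]
    (hlaw : ∀ i, μ.map (U i) = ν) {R : Set (α × α)} (hR : MeasurableSet R) {q : ENNReal}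
    (hq : ∀ z, ν {w | (z, w) ∈ R} ≤ q) {S : Finset ι} {r : ι} (hr : r ∉ S) :
    μ {ω | ∀ i ∈ S, (U r ω, U i ω) ∈ R} ≤ q ^ S.card := by
  have h1 : IndepFun (U r) (fun ω (i : S) => U i ω) μ := by
    have h := hind.indepFun_finset {r} S (by simpa using hr) hU
    exact h.comp (measurable_pi_apply (⟨r, by simp⟩ : ({r} : Finset ι))) measurable_id
  have hV : Measurable fun ω (i : S) => U i ω := measurable_pi_lambda _ fun i => hU i
  have h2 := (indepFun_iff_map_prod_eq_prod_map_map (hU r).aemeasurable hV.aemeasurable).1 h1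
  rw [hlaw, map_tuple_eq_pi hU hind hlaw (J := fun i : S => (i : ι)) Subtype.val_injective] at h2
  let E : Set (α × (S → α)) := {zv | ∀ i, (zv.1, zv.2 i) ∈ R}
  have hE : MeasurableSet E := by
    have : E = ⋂ i : S, (fun zv : α × (S → α) => (zv.1, zv.2 i)) ⁻¹' R := by ext; simp [E]
    rw [this]
    exact MeasurableSet.iInter fun i => (by fun_prop : Measurable fun zv : α × (S → α) =>
      (zv.1, zv.2 i)) hR
  have h3 : {ω | ∀ i ∈ S, (U r ω, U i ω) ∈ R} = (fun ω => (U r ω, fun i : S => U i ω)) ⁻¹' E := by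
    ext ω
    simp [E]
  rw [h3, ← Measure.map_apply ((hU r).prodMk hV) hE, h2, Measure.prod_apply hE]
  calc ∫⁻ z, Measure.pi (fun _ : S => ν) (Prod.mk z ⁻¹' E) ∂ν ≤ ∫⁻ _, q ^ S.card ∂ν := by
        refine lintegral_mono fun z => ?_
        have : Prod.mk z ⁻¹' E = univ.pi fun _ : S => {w | (z, w) ∈ R} := by
          ext v; simp [E]
        rw [this, Measure.pi_pi]
        refine (Finset.prod_le_prod' fun _ _ => hq z).trans ?_
        simp
    _ = q ^ S.card := by simp

end Tuples

theorem lintegral_pi_prod {d : ℕ} (μ : Fin d → Measure ℝ) [∀ i, SigmaFinite (μ i)]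
    {f : Fin d → ℝ → ENNReal} (hf : ∀ i, Measurable (f i)) :
    ∫⁻ s, ∏ i, f i (s i) ∂(Measure.pi μ) = ∏ i, ∫⁻ x, f i x ∂(μ i) := by
  induction d with
  | zero => simp
  | succ d ih =>
    have h := (measurePreserving_piFinSuccAbove μ 0)
    have h2 := h.lintegral_comp (f := fun zs : ℝ × (Fin d → ℝ) =>
      f 0 zs.1 * ∏ i : Fin d, f i.succ (zs.2 i)) (by fun_prop)
    have h3 : (fun s : Fin (d + 1) → ℝ => ∏ i, f i (s i)) = fun s =>
        f 0 ((MeasurableEquiv.piFinSuccAbove (fun _ => ℝ) 0) s).1 *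
        ∏ i : Fin d, f i.succ (((MeasurableEquiv.piFinSuccAbove (fun _ => ℝ) 0) s).2 i) := by
      funext s
      rw [Fin.prod_univ_succ]
      rfl
    have h4 : Measurable fun v : Fin d → ℝ => ∏ i, f i.succ (v i) := by fun_prop
    rw [h3, h2, lintegral_prod_mul (hf 0).aemeasurable h4.aemeasurable, Fin.prod_univ_succ]
    congr 1
    exact ih (fun i => μ i.succ) (fun i => hf i.succ)

theorem pi_withDensity {d : ℕ} (μ : Measure ℝ) [SigmaFinite μ]
    {f : ℝ → ENNReal} (hf : Measurable f) [SigmaFinite (μ.withDensity f)] :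
    (Measure.pi fun _ : Fin d => μ.withDensity f) =
      (Measure.pi fun _ : Fin d => μ).withDensity fun s => ∏ i, f (s i) := by
  refine Measure.pi_eq fun t ht => ?_
  rw [withDensity_apply _ (MeasurableSet.univ_pi ht), Measure.restrict_pi_pi,
    lintegral_pi_prod _ fun _ => hf]
  exact Finset.prod_congr rfl fun i _ => (withDensity_apply _ (ht i)).symm

/-! ### The density of the central angles -/

/-- The density, on `[0, 2π)^d`, of the angles from the first of `d + 1` points to the others. -/
def angleDensity {d : ℕ} (p : ℝ → ℝ) (y : Fin d → ℝ) : ℝ :=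
  ∫ x in (0 : ℝ)..(2 * Real.pi), p x * ∏ i, p (x + y i)

theorem continuous_angleDensity {d : ℕ} {p : ℝ → ℝ} (hp : Continuous p) :
    Continuous (angleDensity (d := d) p) := by
  refine intervalIntegral.continuous_parametric_intervalIntegral_of_continuous' ?_ _ _
  change Continuous fun z : (Fin d → ℝ) × ℝ => p z.2 * ∏ i, p (z.2 + z.1 i)
  fun_prop

theorem angleDensity_nonneg {d : ℕ} {p : ℝ → ℝ} (hp0 : ∀ x, 0 ≤ p x) (y : Fin d → ℝ) :
    0 ≤ angleDensity p y :=
  intervalIntegral.integral_nonneg Real.two_pi_pos.le fun _ _ =>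
    mul_nonneg (hp0 _) (Finset.prod_nonneg fun _ _ => hp0 _)

theorem angleDensity_comp_perm {d : ℕ} (p : ℝ → ℝ) (y : Fin d → ℝ) (σ : Equiv.Perm (Fin d)) :
    angleDensity p (y ∘ σ) = angleDensity p y := by
  unfold angleDensity
  congr 1
  funext x
  congr 1
  exact Equiv.prod_comp σ fun i => p (x + y i)

theorem exists_angleDensity_le {d : ℕ} {p : ℝ → ℝ} (hp : Continuous p) (hp0 : ∀ x, 0 ≤ p x)
    (hper : Function.Periodic p (2 * Real.pi)) :
    ∃ B : ℝ, ∀ y : Fin d → ℝ, angleDensity p y ≤ B := by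
  obtain ⟨M, hM, hpM⟩ := exists_bound_of_periodic hp hper
  refine ⟨∫ _x in (0 : ℝ)..(2 * Real.pi), M * M ^ d, fun y => ?_⟩
  refine intervalIntegral.integral_mono Real.two_pi_pos.le
    ((by fun_prop : Continuous fun x => p x * ∏ i, p (x + y i)).intervalIntegrable _ _)
    (continuous_const.intervalIntegrable _ _) fun x => ?_
  refine mul_le_mul (hpM x) ?_ (Finset.prod_nonneg fun _ _ => hp0 _) hM.le
  calc ∏ i, p (x + y i) ≤ ∏ _i : Fin d, M := Finset.prod_le_prod (fun _ _ => hp0 _) fun _ _ => hpM _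
    _ = M ^ d := by simp

theorem kernel_cons_exp {d : ℕ} (g : ℝ → ℝ) (x : ℝ) {s : Fin d → ℝ}
    (hs : ∀ i, s i ∈ Ico 0 (2 * Real.pi)) :
    kernel g (Fin.cons (α := fun _ => Circle) (Circle.exp x) fun i => Circle.exp (x + s i)) =
      gapSum g (Fin.cons (α := fun _ => ℝ) 0 s) := by
  unfold kernel
  congr 1
  funext i
  refine Fin.cases ?_ (fun i => ?_) i
  · simp [centralAngle_self]
  · simp only [Fin.cons_zero, Fin.cons_succ, Circle.exp_add]
    exact centralAngle_mul_exp _ (hs i)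

instance sigmaFinite_angleLaw (q : ℝ → ℝ) : SigmaFinite (angleLaw q) := by
  unfold angleLaw
  infer_instance

/-- Given the first point at angle `x`, the other central angles are independent with densities `p
(x + ·)`, and the kernel depends on them alone. Tonelli's theorem then integrates `x` out, which
produces `angleDensity`. -/
theorem pi_circleLaw_kernel_le {d : ℕ} {p : ℝ → ℝ} (hp : Continuous p) (hp0 : ∀ x, 0 ≤ p x)
    (hper : Function.Periodic p (2 * Real.pi)) [IsProbabilityMeasure (circleLaw p)]
    {g : ℝ → ℝ} (hg : Measurable g) (c : ℝ) :
    (Measure.pi fun _ : Fin (d + 1) => circleLaw p) {u | kernel g u ≤ c} =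
      ∫⁻ y in {y : Fin d → ℝ | (∀ i, y i ∈ Ico 0 (2 * Real.pi)) ∧
        gapSum g (Fin.cons (α := fun _ => ℝ) 0 y) ≤ c}, ENNReal.ofReal (angleDensity p y) := by
  set E : Set (Fin (d + 1) → Circle) := {u | kernel g u ≤ c} with hEdef
  have hE : MeasurableSet E := measurableSet_le (measurable_kernel hg) measurable_const
  have hcons : Measurable fun y : Fin d → ℝ => (Fin.cons (α := fun _ => ℝ) 0 y : Fin (d + 1) → ℝ) := by
    refine measurable_pi_lambda _ fun i => Fin.cases ?_ (fun i => ?_) i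
    · simp
    · simpa using measurable_pi_apply i
  set B : Set (Fin d → ℝ) := {y | gapSum g (Fin.cons (α := fun _ => ℝ) 0 y) ≤ c} with hBdef
  have hB : MeasurableSet B :=
    measurableSet_le ((measurable_gapSum hg).comp hcons) measurable_const
  set Q : Set (Fin d → ℝ) := univ.pi fun _ => Ico 0 (2 * Real.pi) with hQdef
  have hQ : MeasurableSet Q := MeasurableSet.univ_pi fun _ => measurableSet_Ico
  have hset : {y : Fin d → ℝ | (∀ i, y i ∈ Ico 0 (2 * Real.pi)) ∧
      gapSum g (Fin.cons (α := fun _ => ℝ) 0 y) ≤ c} = B ∩ Q := by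
    ext y
    simp only [hBdef, hQdef, mem_ofPred_eq, mem_inter_iff, Set.mem_pi, mem_univ, true_implies]
    exact and_comm
  have hmp := (measurePreserving_piFinSuccAbove
    (fun _ : Fin (d + 1) => circleLaw p) 0).symm
  have hsplit : (Measure.pi fun _ : Fin (d + 1) => circleLaw p) E =
      ∫⁻ z, (Measure.pi fun _ : Fin d => circleLaw p)
        {v | (Fin.cons (α := fun _ => Circle) z v : Fin (d + 1) → Circle) ∈ E} ∂(circleLaw p) := by
    rw [← hmp.measure_preimage hE.nullMeasurableSet, Measure.prod_apply (hmp.measurable hE)]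
    refine lintegral_congr fun z => ?_
    congr 1
    ext v
    simp [MeasurableEquiv.piFinSuccAbove, Fin.insertNthEquiv]
  have hinner (x : ℝ) : (Measure.pi fun _ : Fin d => circleLaw p)
      {v | (Fin.cons (α := fun _ => Circle) (Circle.exp x) v : Fin (d + 1) → Circle) ∈ E} =
      ∫⁻ s in B ∩ Q, ∏ i, ENNReal.ofReal (p (x + s i)) := by
    have hexp : Measurable fun s => Circle.exp (x + s) :=
      (Circle.exp.continuous.comp (continuous_const.add continuous_id)).measurable
    have hconsE : MeasurableSet
        {v : Fin d → Circle | (Fin.cons (α := fun _ => Circle) (Circle.exp x) v : Fin (d + 1) → Circle) ∈ E} := by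
      have : Measurable fun v : Fin d → Circle =>
          (Fin.cons (α := fun _ => Circle) (Circle.exp x) v : Fin (d + 1) → Circle) := by
        refine measurable_pi_lambda _ fun i => Fin.cases ?_ (fun i => ?_) i
        · simp
        · simpa using measurable_pi_apply i
      exact this hE
    have hmap := circleLaw_eq_map_add hper x
    have hsf : ∀ _ : Fin d, SigmaFinite ((angleLaw fun s => p (x + s)).map
        fun s => Circle.exp (x + s)) := fun _ => by rw [← hmap]; infer_instance
    have hpi := Measure.pi_map_pi (hμ := hsf) (ι := Fin d) (μ := fun _ => angleLaw fun s => p (x + s))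
      (f := fun _ s => Circle.exp (x + s)) fun _ => hexp.aemeasurable
    rw [← hmap] at hpi
    have hT : Measurable fun (s : Fin d → ℝ) (i : Fin d) => Circle.exp (x + s i) :=
      measurable_pi_lambda _ fun i => hexp.comp (measurable_pi_apply i)
    rw [← hpi, Measure.map_apply hT hconsE]
    have hden : Measurable fun s : ℝ => ENNReal.ofReal (p (x + s)) := by fun_prop
    have hsf' : SigmaFinite ((volume.restrict (Ico 0 (2 * Real.pi))).withDensity
      fun s => ENNReal.ofReal (p (x + s))) := sigmaFinite_angleLaw _
    have hpiden := pi_withDensity (d := d) (volume.restrict (Ico 0 (2 * Real.pi))) hden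
    change (Measure.pi fun _ : Fin d => (volume.restrict (Ico 0 (2 * Real.pi))).withDensity
      fun s => ENNReal.ofReal (p (x + s))) _ = _
    rw [hpiden, ← Measure.restrict_pi_pi, ← volume_pi, withDensity_apply _ (hT hconsE),
      Measure.restrict_restrict (hT hconsE)]
    congr 2
    ext s
    simp only [mem_inter_iff, mem_preimage, mem_ofPred_eq, hQdef, Set.mem_pi, mem_univ, true_implies,
      hBdef, hEdef]
    refine and_congr_left fun hs => ?_
    rw [kernel_cons_exp g x hs]
  have hf : Measurable fun z : Circle => (Measure.pi fun _ : Fin d => circleLaw p)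
        {v | (Fin.cons (α := fun _ => Circle) z v : Fin (d + 1) → Circle) ∈ E} := by
    have : Measurable fun zv : Circle × (Fin d → Circle) =>
        (Fin.cons (α := fun _ => Circle) zv.1 zv.2 : Fin (d + 1) → Circle) := by
      refine measurable_pi_lambda _ fun i => Fin.cases ?_ (fun i => ?_) i
      · simpa using measurable_fst
      · simp only [Fin.cons_succ]
        fun_prop
    exact measurable_measure_prodMk_left (this hE)
  rw [hsplit, hset]
  refine (lintegral_map (μ := angleLaw p) hf Circle.exp.continuous.measurable).trans ?_
  simp only [hinner]
  rw [angleLaw, lintegral_withDensity_eq_lintegral_mul₀ (by fun_prop)]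
  swap
  · refine Measurable.aemeasurable ?_
    refine Measurable.lintegral_prod_right' (f := fun z : ℝ × (Fin d → ℝ) =>
      ∏ i, ENNReal.ofReal (p (z.1 + z.2 i))) ?_
    fun_prop
  simp only [Pi.mul_apply]
  have hswap : ∫⁻ x in Ico 0 (2 * Real.pi), ENNReal.ofReal (p x) *
      ∫⁻ s in B ∩ Q, ∏ i, ENNReal.ofReal (p (x + s i)) =
      ∫⁻ x in Ico 0 (2 * Real.pi), ∫⁻ s in B ∩ Q,
        ENNReal.ofReal (p x * ∏ i, p (x + s i)) := by
    refine lintegral_congr fun x => ?_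
    rw [← lintegral_const_mul _ (by fun_prop)]
    refine lintegral_congr fun s => ?_
    rw [ENNReal.ofReal_mul (hp0 x), ENNReal.ofReal_prod_of_nonneg fun _ _ => hp0 _]
  rw [hswap, lintegral_lintegral_swap (by fun_prop)]
  refine lintegral_congr fun s => ?_
  have hcont : Continuous fun x => p x * ∏ i, p (x + s i) := by fun_prop
  rw [angleDensity, intervalIntegral.integral_of_le Real.two_pi_pos.le,
    setLIntegral_congr Ico_ae_eq_Ioc, ofReal_integral_eq_lintegral_ofReal]
  · exact (hcont.integrableOn_Icc (a := 0) (b := 2 * Real.pi)).mono_set Ioc_subset_Icc_self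
  · exact Eventually.of_forall fun x => mul_nonneg (hp0 _) (Finset.prod_nonneg fun _ _ => hp0 _)

/-! ### Symmetric integrands, scaling, and the volume of an ellipsoid -/

theorem measurePreserving_comp_perm {d : ℕ} (σ : Equiv.Perm (Fin d)) :
    MeasurePreserving (fun y : Fin d → ℝ => y ∘ σ) volume volume := by
  have hm : Measurable fun y : Fin d → ℝ => y ∘ σ :=
    measurable_pi_lambda _ fun i => measurable_pi_apply (σ i)
  refine ⟨hm, ?_⟩
  rw [volume_pi]
  refine (Measure.pi_eq fun t ht => ?_).symm
  rw [Measure.map_apply hm (MeasurableSet.univ_pi ht)]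
  have : (fun y : Fin d → ℝ => y ∘ σ) ⁻¹' univ.pi t = univ.pi fun i => t (σ.symm i) := by
    ext y
    simp only [mem_preimage, Set.mem_pi, mem_univ, true_implies, Function.comp_apply]
    exact ⟨fun h i => by simpa using h (σ.symm i), fun h i => by simpa using h (σ i)⟩
  rw [this, Measure.pi_pi]
  exact Equiv.prod_comp σ.symm fun i => volume (t i)

theorem measurableSet_strictMono (d : ℕ) : MeasurableSet {y : Fin d → ℝ | StrictMono y} := by
  have : {y : Fin d → ℝ | StrictMono y} = ⋂ i, ⋂ j, ⋂ _ : i < j, {y | y i < y j} := by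
    ext y
    simp [StrictMono]
  rw [this]
  exact MeasurableSet.iInter fun i => MeasurableSet.iInter fun j => MeasurableSet.iInter fun _ =>
    measurableSet_lt (measurable_pi_apply _) (measurable_pi_apply _)

theorem ae_injective (d : ℕ) : ∀ᵐ y : Fin d → ℝ, Function.Injective y := by
  have h (i j : Fin d) (hij : i ≠ j) : ∀ᵐ y : Fin d → ℝ, y i ≠ y j := by
    let f : (Fin d → ℝ) →ₗ[ℝ] ℝ := LinearMap.proj (R := ℝ) (φ := fun _ : Fin d => ℝ) i - LinearMap.proj j
    have hf : LinearMap.ker f ≠ ⊤ := by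
      rw [Ne, LinearMap.ker_eq_top]
      intro h0
      have := LinearMap.congr_fun h0 (Pi.single i 1)
      simp [f, hij.symm] at this
    have := Measure.addHaar_submodule (volume : Measure (Fin d → ℝ)) _ hf
    rw [ae_iff]
    refine measure_mono_null (fun y hy => ?_) this
    simp only [ne_eq, not_not, mem_ofPred_eq] at hy
    simp [f, hy]
  have h' : ∀ᵐ y : Fin d → ℝ, ∀ i j, i ≠ j → y i ≠ y j := by
    simp only [ae_all_iff]
    exact h
  filter_upwards [h'] with y hy i j hij
  by_contra hne
  exact hy i j hne hij

/-- The integral of a symmetric function is `d!` times its integral over ordered tuples. -/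
theorem lintegral_of_symmetric {d : ℕ} {ψ : (Fin d → ℝ) → ENNReal} (hψ : Measurable ψ)
    (hsymm : ∀ (σ : Equiv.Perm (Fin d)) (y : Fin d → ℝ), ψ (y ∘ σ) = ψ y) :
    ∫⁻ y, ψ y = (d.factorial : ENNReal) * ∫⁻ y in {y : Fin d → ℝ | StrictMono y}, ψ y := by
  let S : Equiv.Perm (Fin d) → Set (Fin d → ℝ) := fun σ => (fun y => y ∘ σ) ⁻¹' {y | StrictMono y}
  have hS (σ) : MeasurableSet (S σ) :=
    (measurePreserving_comp_perm σ).measurable (measurableSet_strictMono d)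
  have hdisj : Pairwise (Function.onFun Disjoint S) := by
    intro σ τ hστ
    rw [Function.onFun, Set.disjoint_left]
    intro y hy hy'
    have h1 : StrictMono (y ∘ σ) := hy
    have h2 : StrictMono (y ∘ τ) := hy'
    have h3 := Tuple.unique_monotone h1.monotone h2.monotone
    have hinj : Function.Injective y := by
      intro i j hij
      have := h1.injective (a₁ := σ.symm i) (a₂ := σ.symm j) (by simpa using hij)
      simpa using this
    exact hστ (Equiv.ext fun i => hinj (congrFun h3 i))
  have hU : (⋃ σ, S σ) =ᵐ[volume] (univ : Set (Fin d → ℝ)) := by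
    rw [eventuallyEq_univ]
    filter_upwards [ae_injective d] with y hy
    simp only [mem_iUnion]
    exact ⟨Tuple.sort y, (Tuple.monotone_sort y).strictMono_of_injective
      (hy.comp (Tuple.sort y).injective)⟩
  rw [← setLIntegral_univ, ← setLIntegral_congr hU, lintegral_iUnion hS hdisj, tsum_fintype]
  have hσ (σ : Equiv.Perm (Fin d)) :
      ∫⁻ y in S σ, ψ y = ∫⁻ y in {y : Fin d → ℝ | StrictMono y}, ψ y := by
    rw [← (measurePreserving_comp_perm σ).setLIntegral_comp_preimage
      (measurableSet_strictMono d) hψ]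
    simp only [hsymm]
    rfl
  simp only [hσ, Finset.sum_const, Finset.card_univ, nsmul_eq_mul, Fintype.card_perm,
    Fintype.card_fin]

theorem lintegral_eq_pow_mul_lintegral_add_smul {d : ℕ} {ψ : (Fin d → ℝ) → ENNReal}
    (hψ : Measurable ψ) (s : Fin d → ℝ) {η : ℝ} (hη : 0 < η) :
    ∫⁻ y, ψ y = ENNReal.ofReal (η ^ d) * ∫⁻ v : Fin d → ℝ, ψ (s + η • v) := by
  have h1 : ∫⁻ y, ψ y = ∫⁻ y, ψ (s + y) := (lintegral_add_left_eq_self ψ s).symm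
  have hm : Measurable fun y => ψ (s + y) := hψ.comp (measurable_const_add s)
  have h2 := lintegral_map (μ := (volume : Measure (Fin d → ℝ))) hm
    (measurable_const_smul η : Measurable fun v : Fin d → ℝ => η • v)
  rw [Measure.map_addHaar_smul _ hη.ne', lintegral_smul_measure, Module.finrank_fin_fun,
    abs_of_pos (by positivity)] at h2
  rw [h1, ← h2, smul_eq_mul, ← mul_assoc, ← ENNReal.ofReal_mul (by positivity),
    mul_inv_cancel₀ (by positivity), ENNReal.ofReal_one, one_mul]

/-- The increments of the closed sequence `0, v₀, …, v_{d-1}, b`. -/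
def increments {d : ℕ} (b : ℝ) (v : Fin d → ℝ) (i : Fin (d + 1)) : ℝ :=
  (Fin.snoc (α := fun _ => ℝ) (Fin.cons (α := fun _ => ℝ) 0 v : Fin (d + 1) → ℝ) b) i.succ -
    (Fin.snoc (α := fun _ => ℝ) (Fin.cons (α := fun _ => ℝ) 0 v : Fin (d + 1) → ℝ) b) i.castSucc

theorem sum_increments {d : ℕ} (b : ℝ) (v : Fin d → ℝ) : ∑ i, increments b v i = b := by
  have h0 : (Fin.snoc (α := fun _ => ℝ) (Fin.cons (α := fun _ => ℝ) 0 v : Fin (d + 1) → ℝ) b) 0 = 0 := by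
    rw [← Fin.castSucc_zero, Fin.snoc_castSucc, Fin.cons_zero]
  unfold increments
  rw [sum_fin_succ_sub_castSucc, h0, Fin.snoc_last, sub_zero]

theorem increments_castSucc {d : ℕ} (b : ℝ) (v : Fin d → ℝ) (i : Fin d) :
    increments b v i.castSucc =
      v i - (Fin.cons (α := fun _ => ℝ) 0 v : Fin (d + 1) → ℝ) i.castSucc := by
  rw [increments, Fin.succ_castSucc, Fin.snoc_castSucc, Fin.snoc_castSucc, Fin.cons_succ]

/-- The map from a vector to its successive increments. -/
def differenceMap (d : ℕ) : (Fin d → ℝ) →ₗ[ℝ] (Fin d → ℝ) where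
  toFun v i := v i - (Fin.cons (α := fun _ => ℝ) 0 v : Fin (d + 1) → ℝ) i.castSucc
  map_add' v w := by
    funext i
    have : (Fin.cons (α := fun _ => ℝ) 0 (v + w) : Fin (d + 1) → ℝ) i.castSucc =
        (Fin.cons (α := fun _ => ℝ) 0 v : Fin (d + 1) → ℝ) i.castSucc +
        (Fin.cons (α := fun _ => ℝ) 0 w : Fin (d + 1) → ℝ) i.castSucc := by
      refine Fin.cases ?_ (fun j => ?_) i.castSucc <;> simp
    simp only [Pi.add_apply, this]
    ring
  map_smul' c v := by
    funext i
    have : (Fin.cons (α := fun _ => ℝ) 0 (c • v) : Fin (d + 1) → ℝ) i.castSucc =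
        c * (Fin.cons (α := fun _ => ℝ) 0 v : Fin (d + 1) → ℝ) i.castSucc := by
      refine Fin.cases ?_ (fun j => ?_) i.castSucc <;> simp
    simp only [Pi.smul_apply, this, smul_eq_mul, RingHom.id_apply]
    ring

/-- The matrix is lower triangular with unit diagonal. -/
theorem det_differenceMap (d : ℕ) : LinearMap.det (differenceMap d) = 1 := by
  rw [← LinearMap.det_toMatrix', Matrix.det_of_isLowerTriangular]
  · refine Finset.prod_eq_one fun i _ => ?_
    rw [LinearMap.toMatrix'_apply]
    simp only [differenceMap, LinearMap.coe_mk, AddHom.coe_mk, Pi.single_eq_same]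
    have : (Fin.cons (α := fun _ => ℝ) 0 (Pi.single i (1 : ℝ) : Fin d → ℝ) : Fin (d + 1) → ℝ)
        i.castSucc = 0 := by
      rcases Fin.eq_zero_or_eq_succ i.castSucc with h | ⟨k, hk⟩
      · rw [h, Fin.cons_zero]
      · rw [hk, Fin.cons_succ, Pi.single_eq_of_ne]
        rintro rfl
        exact absurd hk (Fin.castSucc_lt_succ).ne
    rw [this, sub_zero]
  · intro i j hij
    have hij' : i < j := hij
    rw [LinearMap.toMatrix'_apply]
    simp only [differenceMap, LinearMap.coe_mk, AddHom.coe_mk, Pi.single_eq_of_ne hij'.ne]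
    rcases Fin.eq_zero_or_eq_succ i.castSucc with h | ⟨k, hk⟩
    · rw [h, Fin.cons_zero, sub_zero]
    · rw [hk, Fin.cons_succ, Pi.single_eq_of_ne, sub_zero]
      rintro rfl
      have h1 := congrArg Fin.val hk
      simp at h1
      have h2 : (i : ℕ) < k := hij'
      omega

/-- A square root of the matrix `1 + J`, where `J` is the all-ones matrix of size `d`. -/
def sqrtOneAddOnes (d : ℕ) : Matrix (Fin d) (Fin d) ℝ :=
  1 + Matrix.replicateCol Unit (fun _ : Fin d => (Real.sqrt (d + 1) + 1)⁻¹) *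
    Matrix.replicateRow Unit (fun _ : Fin d => (1 : ℝ))

/-- Determinant of a rank-one update of the identity: `1 + d / (√(d+1) + 1) = √(d+1)`. -/
theorem det_sqrtOneAddOnes (d : ℕ) : (sqrtOneAddOnes d).det = Real.sqrt (d + 1) := by
  have h : Real.sqrt (d + 1) ^ 2 = d + 1 := Real.sq_sqrt (by positivity)
  have h0 : 0 ≤ Real.sqrt (d + 1) := Real.sqrt_nonneg _
  rw [sqrtOneAddOnes, Matrix.det_one_add_replicateCol_mul_replicateRow]
  simp only [dotProduct, one_mul, Finset.sum_const, Finset.card_univ, Fintype.card_fin,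
    nsmul_eq_mul]
  field_simp
  linarith

theorem sqrtOneAddOnes_mulVec {d : ℕ} (w : Fin d → ℝ) (i : Fin d) :
    (sqrtOneAddOnes d).mulVec w i = w i + (Real.sqrt (d + 1) + 1)⁻¹ * ∑ j, w j := by
  rw [sqrtOneAddOnes, Matrix.add_mulVec, Matrix.one_mulVec, Pi.add_apply]
  simp [Matrix.mulVec, dotProduct, Matrix.mul_apply, Finset.mul_sum]

theorem sum_sq_sqrtOneAddOnes_mulVec {d : ℕ} (w : Fin d → ℝ) :
    ∑ i, ((sqrtOneAddOnes d).mulVec w i) ^ 2 = ∑ i, w i ^ 2 + (∑ i, w i) ^ 2 := by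
  have h : Real.sqrt (d + 1) ^ 2 = d + 1 := Real.sq_sqrt (by positivity)
  have h0 : 0 ≤ Real.sqrt (d + 1) := Real.sqrt_nonneg _
  simp only [sqrtOneAddOnes_mulVec]
  set c := (Real.sqrt (d + 1) + 1)⁻¹ with hc
  -- This is the equation for `c` that makes `(1 + c J)² = 1 + J`, using `J² = d J`.
  have hcc : 2 * c + d * c ^ 2 = 1 := by
    have : (d : ℝ) = Real.sqrt (d + 1) ^ 2 - 1 := by linarith
    rw [hc]
    field_simp
    linarith
  set s := ∑ i, w i with hs
  have : ∑ i, (w i + c * s) ^ 2 = ∑ i, w i ^ 2 + 2 * c * s * ∑ i, w i + d * (c * s) ^ 2 := by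
    simp only [add_sq, Finset.sum_add_distrib, Finset.mul_sum]
    congr 1
    · congr 1
      exact Finset.sum_congr rfl fun i _ => by ring
    · simp
  rw [this, ← hs]
  linear_combination s ^ 2 * hcc

/-- A linear map turning the quadratic form of the increments into the Euclidean one. -/
def incrementsIsometry (d : ℕ) : (Fin d → ℝ) →ₗ[ℝ] (Fin d → ℝ) :=
  Matrix.toLin' (sqrtOneAddOnes d) ∘ₗ differenceMap d

theorem det_incrementsIsometry (d : ℕ) :
    LinearMap.det (incrementsIsometry d) = Real.sqrt (d + 1) := by
  rw [incrementsIsometry, LinearMap.det_comp, LinearMap.det_toLin', det_sqrtOneAddOnes,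
    det_differenceMap, mul_one]

/-- The increments sum to zero, so the last one is minus the sum of the first `d`. The form is
therefore `|w|² + (∑ w)²` in those `w`, with matrix `1 + J`. -/
theorem sum_sq_increments {d : ℕ} (v : Fin d → ℝ) :
    ∑ i, increments 0 v i ^ 2 = ∑ i, (incrementsIsometry d v i) ^ 2 := by
  have h1 : ∀ i : Fin d, increments 0 v i.castSucc = differenceMap d v i := fun i =>
    increments_castSucc 0 v i
  have h2 := sum_increments 0 v
  rw [Fin.sum_univ_castSucc] at h2 ⊢
  simp only [h1] at h2 ⊢
  have h3 : increments 0 v (Fin.last d) ^ 2 = (∑ i, differenceMap d v i) ^ 2 := by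
    rw [← sub_eq_zero]
    linear_combination (increments 0 v (Fin.last d) - ∑ i, differenceMap d v i) * h2
  rw [h3, ← sum_sq_sqrtOneAddOnes_mulVec]
  rfl

/-- The volume of the ellipsoid `{v | ∑ (vᵢ - vᵢ₋₁)² ≤ ρ}`, where `v₋₁ = v_d = 0`. -/
def ellipsoidVolume (d : ℕ) (ρ : ℝ) : ℝ :=
  Real.sqrt ρ ^ d * (Real.sqrt Real.pi ^ d / Real.Gamma (d / 2 + 1)) / Real.sqrt (d + 1)

theorem two_mul_Gamma_half_add_one : 2 * Real.Gamma (1 / 2 + 1) = Real.sqrt Real.pi := by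
  rw [Real.Gamma_add_one (by norm_num), Real.Gamma_one_half_eq]
  ring

theorem volume_preimage_incrementsIsometry {d : ℕ} {ρ : ℝ}
    {s : Set (Fin d → ℝ)} (hs : volume s = ENNReal.ofReal (Real.sqrt ρ) ^ d *
      ENNReal.ofReal ((2 * Real.Gamma (1 / 2 + 1)) ^ d / Real.Gamma (d / 2 + 1))) :
    volume (incrementsIsometry d ⁻¹' s) = ENNReal.ofReal (ellipsoidVolume d ρ) := by
  have hdet : LinearMap.det (incrementsIsometry d) ≠ 0 := by
    rw [det_incrementsIsometry]; positivity
  have hG : 0 < Real.Gamma ((d : ℝ) / 2 + 1) := Real.Gamma_pos_of_pos (by positivity)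
  rw [Measure.addHaar_preimage_linearMap _ hdet, det_incrementsIsometry, hs,
    two_mul_Gamma_half_add_one, ← ENNReal.ofReal_pow (Real.sqrt_nonneg _),
    ← ENNReal.ofReal_mul (by positivity), ← ENNReal.ofReal_mul (by positivity),
    abs_of_pos (by positivity), ellipsoidVolume]
  congr 1
  field_simp

theorem volume_ellipsoid_le {d : ℕ} (hd : 0 < d) {ρ : ℝ} (hρ : 0 ≤ ρ) :
    volume {v : Fin d → ℝ | ∑ i, increments 0 v i ^ 2 ≤ ρ} =
      ENNReal.ofReal (ellipsoidVolume d ρ) := by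
  have : Nonempty (Fin d) := ⟨⟨0, hd⟩⟩
  have h := volume_sum_rpow_le (Fin d) (p := 2) one_le_two (Real.sqrt ρ)
  rw [Fintype.card_fin] at h
  rw [← volume_preimage_incrementsIsometry h]
  congr 1
  ext v
  simp only [mem_ofPred_eq, mem_preimage, sum_sq_increments, Real.rpow_two, sq_abs,
    ← Real.sqrt_eq_rpow]
  exact (Real.sqrt_le_sqrt_iff hρ).symm

theorem volume_ellipsoid_lt {d : ℕ} (hd : 0 < d) (ρ : ℝ) :
    volume {v : Fin d → ℝ | ∑ i, increments 0 v i ^ 2 < ρ} =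
      ENNReal.ofReal (ellipsoidVolume d ρ) := by
  have : Nonempty (Fin d) := ⟨⟨0, hd⟩⟩
  have h := volume_sum_rpow_lt (Fin d) (p := 2) one_le_two (Real.sqrt ρ)
  rw [Fintype.card_fin] at h
  rw [← volume_preimage_incrementsIsometry h]
  congr 1
  ext v
  simp only [mem_ofPred_eq, mem_preimage, sum_sq_increments, Real.rpow_two, sq_abs,
    ← Real.sqrt_eq_rpow]
  exact (Real.sqrt_lt_sqrt_iff (Finset.sum_nonneg fun i _ => sq_nonneg _)).symm

theorem continuous_increments {d : ℕ} (b : ℝ) (i : Fin (d + 1)) :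
    Continuous fun v : Fin d → ℝ => increments b v i := by
  have hc (k : Fin (d + 2)) : Continuous fun v : Fin d → ℝ =>
      (Fin.snoc (α := fun _ => ℝ) (Fin.cons (α := fun _ => ℝ) 0 v : Fin (d + 1) → ℝ) b) k := by
    refine Fin.lastCases ?_ (fun k => Fin.cases ?_ (fun k => ?_) k) k
    · simp only [Fin.snoc_last]; exact continuous_const
    · simp only [Fin.snoc_castSucc, Fin.cons_zero]; exact continuous_const
    · simp only [Fin.snoc_castSucc, Fin.cons_succ]; exact continuous_apply k
  exact (hc _).sub (hc _)

/-- The closed and open ellipsoids have the same finite volume. The boundary is where the rescaled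
indicators need not converge. -/
theorem ae_sum_sq_increments_ne {d : ℕ} (hd : 0 < d) {ρ : ℝ} (hρ : 0 ≤ ρ) :
    ∀ᵐ v : Fin d → ℝ, ∑ i, increments 0 v i ^ 2 ≠ ρ := by
  rw [ae_iff]
  have hcont : Continuous fun v : Fin d → ℝ => ∑ i, increments 0 v i ^ 2 :=
    continuous_finsetSum _ fun i _ => (continuous_increments 0 i).pow 2
  have hset : {v : Fin d → ℝ | ¬ ∑ i, increments 0 v i ^ 2 ≠ ρ} =
      {v | ∑ i, increments 0 v i ^ 2 ≤ ρ} \ {v | ∑ i, increments 0 v i ^ 2 < ρ} := by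
    ext v
    simp only [ne_eq, not_not, mem_ofPred_eq, Set.mem_sdiff, not_lt]
    exact ⟨fun h => ⟨h.le, h.ge⟩, fun h => le_antisymm h.1 h.2⟩
  have hsub : {v : Fin d → ℝ | ∑ i, increments 0 v i ^ 2 < ρ} ⊆
      {v | ∑ i, increments 0 v i ^ 2 ≤ ρ} := fun v hv => le_of_lt (mem_ofPred_eq ▸ hv)
  rw [hset, measure_sdiff hsub
    (measurableSet_lt hcont.measurable measurable_const).nullMeasurableSet,
    volume_ellipsoid_le hd hρ, volume_ellipsoid_lt hd ρ, tsub_self]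
  rw [volume_ellipsoid_lt hd ρ]
  exact ENNReal.ofReal_ne_top

/-! ### The probability that one tuple is almost regular -/

theorem monotone_cons_zero {d : ℕ} {y : Fin d → ℝ} (hy : StrictMono y) (h0 : ∀ i, 0 ≤ y i) :
    Monotone (Fin.cons (α := fun _ => ℝ) 0 y : Fin (d + 1) → ℝ) := by
  intro i j hij
  induction i using Fin.cases with
  | zero =>
    induction j using Fin.cases with
    | zero => exact le_rfl
    | succ j => simpa using h0 j
  | succ i =>
    induction j using Fin.cases with
    | zero => exact absurd hij (not_le.2 (Fin.succ_pos i))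
    | succ j => simpa using hy.monotone (Fin.succ_le_succ_iff.1 hij)

theorem gap_cons_zero {d : ℕ} {y : Fin d → ℝ} (hy : StrictMono y) (h0 : ∀ i, 0 ≤ y i) :
    gap (Fin.cons (α := fun _ => ℝ) 0 y : Fin (d + 1) → ℝ) = increments (2 * Real.pi) y := by
  funext i
  rw [gap, orderedAngles_of_monotone (monotone_cons_zero hy h0), increments]

/-- The permutation `σ` extends to one of `Fin (d + 1)` that fixes `0`, and gaps ignore
permutations. This symmetry allows restriction to increasing angle vectors. -/
theorem gapSum_cons_zero_comp_perm {d : ℕ} (g : ℝ → ℝ) (y : Fin d → ℝ) (σ : Equiv.Perm (Fin d)) :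
    gapSum g (Fin.cons (α := fun _ => ℝ) 0 (y ∘ σ) : Fin (d + 1) → ℝ) =
      gapSum g (Fin.cons (α := fun _ => ℝ) 0 y : Fin (d + 1) → ℝ) := by
  let τ : Equiv.Perm (Fin (d + 1)) := Equiv.Perm.decomposeFin.symm (0, σ)
  have : (Fin.cons (α := fun _ => ℝ) 0 (y ∘ σ) : Fin (d + 1) → ℝ) =
      (Fin.cons (α := fun _ => ℝ) 0 y : Fin (d + 1) → ℝ) ∘ τ := by
    funext i
    refine Fin.cases ?_ (fun i => ?_) i <;> simp [τ]
  rw [this, gapSum_eq_sum_gap, gapSum_eq_sum_gap, gap_comp_perm]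

/-- The angles from one vertex of the regular `d + 1`-gon to the others. -/
def regularAngles (d : ℕ) (i : Fin d) : ℝ := ((i : ℕ) + 1) * (2 * Real.pi / ((d + 1 : ℕ) : ℝ))

theorem increments_regularAngles_add {d : ℕ} (η : ℝ) (v : Fin d → ℝ) (i : Fin (d + 1)) :
    increments (2 * Real.pi) (regularAngles d + η • v) i =
      2 * Real.pi / ((d + 1 : ℕ) : ℝ) + η * increments 0 v i := by
  have h (k : Fin (d + 2)) : (Fin.snoc (α := fun _ => ℝ) (Fin.cons (α := fun _ => ℝ) 0
      (regularAngles d + η • v) : Fin (d + 1) → ℝ) (2 * Real.pi)) k =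
      (k : ℕ) * (2 * Real.pi / ((d + 1 : ℕ) : ℝ)) +
      η * (Fin.snoc (α := fun _ => ℝ) (Fin.cons (α := fun _ => ℝ) 0 v : Fin (d + 1) → ℝ) 0) k := by
    refine Fin.lastCases ?_ (fun k => Fin.cases ?_ (fun k => ?_) k) k
    · simp only [Fin.snoc_last, Fin.val_last, mul_zero, add_zero]
      field_simp
    · simp
    · rw [Fin.snoc_castSucc, Fin.snoc_castSucc]
      simp [regularAngles]
  rw [increments, increments, h, h]
  simp only [Fin.val_succ, Fin.val_castSucc]
  push_cast
  ring

theorem tendsto_taylor_two_div_sq {g : ℝ → ℝ} {a : ℝ} (h : ContDiffAt ℝ 2 g a) (w : ℝ) :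
    Tendsto (fun η : ℝ => (g (a + η * w) - g a - deriv g a * (η * w)) / η ^ 2) (𝓝[>] 0)
      (𝓝 (iteratedDeriv 2 g a / 2 * w ^ 2)) := by
  have hc : Tendsto (fun η : ℝ => η * w) (𝓝[>] 0) (𝓝 0) := by
    have : Continuous fun η : ℝ => η * w := by fun_prop
    simpa using (this.tendsto 0).mono_left nhdsWithin_le_nhds
  have h1 := (isLittleO_taylor_two h).comp_tendsto hc
  have h2 : ((fun x : ℝ => x ^ 2) ∘ fun η : ℝ => η * w) =O[𝓝[>] 0] fun η : ℝ => η ^ 2 := by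
    refine Asymptotics.IsBigO.of_bound (w ^ 2) (Eventually.of_forall fun η => ?_)
    simp only [Function.comp_apply, mul_pow, norm_mul, norm_pow, Real.norm_eq_abs, sq_abs]
    rw [mul_comm]
  have h3 := (h1.trans_isBigO h2).tendsto_div_nhds_zero.add_const (iteratedDeriv 2 g a / 2 * w ^ 2)
  rw [zero_add] at h3
  refine h3.congr' ?_
  filter_upwards [self_mem_nhdsWithin] with η hη
  have : η ≠ 0 := (ne_of_gt hη)
  simp only [Function.comp_apply]
  field_simp
  ring

/-- The perturbations `increments 0 v` sum to zero, so the first-order terms, which would blow up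
after division by `η²`, cancel in the sum. -/
theorem tendsto_sum_increments_div_sq {d : ℕ} {g : ℝ → ℝ}
    (h : ContDiffAt ℝ 2 g (2 * Real.pi / ((d + 1 : ℕ) : ℝ))) (v : Fin d → ℝ) :
    Tendsto (fun η : ℝ => (∑ i, g (2 * Real.pi / ((d + 1 : ℕ) : ℝ) + η * increments 0 v i) -
        ((d + 1 : ℕ) : ℝ) * g (2 * Real.pi / ((d + 1 : ℕ) : ℝ))) / η ^ 2) (𝓝[>] 0)
      (𝓝 (iteratedDeriv 2 g (2 * Real.pi / ((d + 1 : ℕ) : ℝ)) / 2 *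
        ∑ i, increments 0 v i ^ 2)) := by
  set a := 2 * Real.pi / ((d + 1 : ℕ) : ℝ) with ha
  have h1 := tendsto_finsetSum Finset.univ
    fun (i : Fin (d + 1)) _ => tendsto_taylor_two_div_sq h (increments 0 v i)
  rw [← Finset.mul_sum] at h1
  refine h1.congr fun η => ?_
  rw [← Finset.sum_div, Finset.sum_sub_distrib, Finset.sum_sub_distrib, ← Finset.mul_sum,
    ← Finset.mul_sum, sum_increments]
  simp

theorem angleDensity_regularAngles {d : ℕ} (p : ℝ → ℝ) :
    angleDensity p (regularAngles d) = polygonIntegral (d + 1) p := by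
  unfold angleDensity polygonIntegral
  congr 1
  funext x
  rw [Finset.prod_range_succ', Finset.prod_range, mul_comm]
  congr 1
  · refine Finset.prod_congr rfl fun i _ => ?_
    congr 2
    simp only [regularAngles]
    push_cast
    ring
  · simp

/-- The set of ordered angle vectors whose gap sum is at most `c`. -/
def orderedSublevel (d : ℕ) (g : ℝ → ℝ) (c : ℝ) : Set (Fin d → ℝ) :=
  {y | StrictMono y} ∩ {y | (∀ i, y i ∈ Ico 0 (2 * Real.pi)) ∧
    gapSum g (Fin.cons (α := fun _ => ℝ) 0 y) ≤ c}

theorem measurableSet_sublevel {d : ℕ} {g : ℝ → ℝ} (hg : Measurable g) (c : ℝ) :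
    MeasurableSet {y : Fin d → ℝ | (∀ i, y i ∈ Ico 0 (2 * Real.pi)) ∧
      gapSum g (Fin.cons (α := fun _ => ℝ) 0 y) ≤ c} := by
  have hcons : Measurable fun y : Fin d → ℝ => (Fin.cons (α := fun _ => ℝ) 0 y : Fin (d + 1) → ℝ) := by
    refine measurable_pi_lambda _ fun i => Fin.cases ?_ (fun i => ?_) i
    · simp
    · simpa using measurable_pi_apply i
  have h1 : MeasurableSet {y : Fin d → ℝ | ∀ i, y i ∈ Ico 0 (2 * Real.pi)} := by
    have : {y : Fin d → ℝ | ∀ i, y i ∈ Ico 0 (2 * Real.pi)} =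
        univ.pi fun _ => Ico 0 (2 * Real.pi) := by ext; simp
    rw [this]
    exact MeasurableSet.univ_pi fun _ => measurableSet_Ico
  exact h1.inter (measurableSet_le ((measurable_gapSum hg).comp hcons) measurable_const)

/-- The `d!` orderings contribute equally; the substitution `y = regularAngles d + η • v` then zooms
in on the only increasing vector giving a regular polygon. -/
theorem setLIntegral_sublevel {d : ℕ} {p : ℝ → ℝ} (hp : Continuous p)
    {g : ℝ → ℝ} (hg : Measurable g) (c : ℝ) {η : ℝ} (hη : 0 < η) :
    ∫⁻ y in {y : Fin d → ℝ | (∀ i, y i ∈ Ico 0 (2 * Real.pi)) ∧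
        gapSum g (Fin.cons (α := fun _ => ℝ) 0 y) ≤ c}, ENNReal.ofReal (angleDensity p y) =
      (d.factorial : ENNReal) * (ENNReal.ofReal (η ^ d) *
        ∫⁻ v, (orderedSublevel d g c).indicator (fun y => ENNReal.ofReal (angleDensity p y))
          (regularAngles d + η • v)) := by
  have hR : Measurable fun y : Fin d → ℝ => ENNReal.ofReal (angleDensity p y) :=
    (continuous_angleDensity hp).measurable.ennreal_ofReal
  have hL := measurableSet_sublevel (d := d) hg c
  rw [← lintegral_indicator hL, lintegral_of_symmetric (hR.indicator hL),
    ← lintegral_indicator (measurableSet_strictMono d), indicator_indicator]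
  · exact congrArg _ (lintegral_eq_pow_mul_lintegral_add_smul
      (hR.indicator ((measurableSet_strictMono d).inter hL)) _ hη)
  · intro σ y
    have hiff : (y ∘ σ) ∈ {y : Fin d → ℝ | (∀ i, y i ∈ Ico 0 (2 * Real.pi)) ∧
        gapSum g (Fin.cons (α := fun _ => ℝ) 0 y) ≤ c} ↔
        y ∈ {y : Fin d → ℝ | (∀ i, y i ∈ Ico 0 (2 * Real.pi)) ∧
        gapSum g (Fin.cons (α := fun _ => ℝ) 0 y) ≤ c} := by
      simp only [mem_ofPred_eq, gapSum_cons_zero_comp_perm]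
      refine and_congr_left fun _ => ⟨fun h i => by simpa using h (σ.symm i), fun h i => h (σ i)⟩
    by_cases hy : y ∈ {y : Fin d → ℝ | (∀ i, y i ∈ Ico 0 (2 * Real.pi)) ∧
        gapSum g (Fin.cons (α := fun _ => ℝ) 0 y) ≤ c}
    · rw [indicator_of_mem hy, indicator_of_mem (hiff.2 hy), angleDensity_comp_perm]
    · rw [indicator_of_notMem hy, indicator_of_notMem (mt hiff.1 hy)]

/-- The regular angles lie in the interior of the region of increasing vectors in `[0, 2π)`, so for
each fixed `v` these constraints disappear in the limit. -/
theorem eventually_regularAngles_add_mem (d : ℕ) (v : Fin d → ℝ) :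
    ∀ᶠ η : ℝ in 𝓝[>] 0, StrictMono (regularAngles d + η • v) ∧
      ∀ i, (regularAngles d + η • v) i ∈ Ico 0 (2 * Real.pi) := by
  have ha : 0 < 2 * Real.pi / ((d + 1 : ℕ) : ℝ) := by positivity
  have hc (i : Fin d) : Tendsto (fun η : ℝ => (regularAngles d + η • v) i) (𝓝[>] 0)
      (𝓝 (regularAngles d i)) := by
    have : Continuous fun η : ℝ => (regularAngles d + η • v) i := by
      simp only [Pi.add_apply, Pi.smul_apply, smul_eq_mul]; fun_prop
    simpa using (this.tendsto 0).mono_left nhdsWithin_le_nhds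
  refine Filter.Eventually.and ?_ ?_
  · simp only [StrictMono, eventually_all]
    intro i j hij
    refine (hc i).eventually_lt (hc j) ?_
    have : ((i : ℕ) : ℝ) < ((j : ℕ) : ℝ) := by exact_mod_cast hij
    simp only [regularAngles]
    gcongr
  · rw [eventually_all]
    intro i
    refine (hc i).eventually_mem (Ico_mem_nhds ?_ ?_)
    · simp only [regularAngles]; positivity
    · have : ((i : ℕ) : ℝ) + 1 < ((d + 1 : ℕ) : ℝ) := by exact_mod_cast Nat.succ_lt_succ i.is_lt
      calc regularAngles d i < ((d + 1 : ℕ) : ℝ) * (2 * Real.pi / ((d + 1 : ℕ) : ℝ)) := by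
            simp only [regularAngles]; gcongr
        _ = 2 * Real.pi := by field_simp

/-- Dominated convergence after rescaling by `η`: the indicator of the sublevel set tends to that of
the ellipsoid `∑ (increments 0 v i)² ≤ 2 / g''(a)`, and the density tends to its value at the
regular angles, which is `polygonIntegral`. -/
theorem tendsto_pi_circleLaw_kernel_le {d : ℕ} (hd : 0 < d) {g : ℝ → ℝ} (hgc : Continuous g)
    (hg : ContDiffAt ℝ 2 g (2 * Real.pi / ((d + 1 : ℕ) : ℝ)))
    (hpos : 0 < iteratedDeriv 2 g (2 * Real.pi / ((d + 1 : ℕ) : ℝ)))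
    (hmin : RegularPolygonUniqueMin (d + 1) g)
    {p : ℝ → ℝ} (hp : Continuous p) (hp0 : ∀ x, 0 ≤ p x)
    (hper : Function.Periodic p (2 * Real.pi)) [IsProbabilityMeasure (circleLaw p)] :
    Tendsto (fun η : ℝ => (Measure.pi fun _ : Fin (d + 1) => circleLaw p).real
        {u | kernel g u ≤ ((d + 1 : ℕ) : ℝ) * g (2 * Real.pi / ((d + 1 : ℕ) : ℝ)) + η ^ 2} / η ^ d)
      (𝓝[>] 0)
      (𝓝 (d.factorial * (polygonIntegral (d + 1) p *
        ellipsoidVolume d (2 / iteratedDeriv 2 g (2 * Real.pi / ((d + 1 : ℕ) : ℝ)))))) := by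
  obtain ⟨κ, hκ, hgrow⟩ := exists_quadratic_growth hgc hg hpos hmin
  obtain ⟨B, hB⟩ := exists_angleDensity_le (d := d) hp hp0 hper
  set a := 2 * Real.pi / ((d + 1 : ℕ) : ℝ) with ha
  set c := iteratedDeriv 2 g a with hc
  set F : ℝ := ((d + 1 : ℕ) : ℝ) * g a with hF
  have hRc : Continuous fun y : Fin d → ℝ => ENNReal.ofReal (angleDensity p y) :=
    ENNReal.continuous_ofReal.comp (continuous_angleDensity hp)
  let Φ : ℝ → (Fin d → ℝ) → ENNReal := fun η v => (orderedSublevel d g (F + η ^ 2)).indicator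
    (fun y => ENNReal.ofReal (angleDensity p y)) (regularAngles d + η • v)
  have hgapSum {η : ℝ} {v : Fin d → ℝ} (h1 : StrictMono (regularAngles d + η • v))
      (h2 : ∀ i, (regularAngles d + η • v) i ∈ Ico 0 (2 * Real.pi)) :
      gapSum g (Fin.cons (α := fun _ => ℝ) 0 (regularAngles d + η • v) : Fin (d + 1) → ℝ) =
        ∑ i, g (a + η * increments 0 v i) := by
    rw [gapSum_eq_sum_gap, gap_cons_zero h1 fun i => (h2 i).1]
    simp only [increments_regularAngles_add, ha]
  have hlim : Tendsto (fun η => ∫⁻ v, Φ η v) (𝓝[>] 0)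
      (𝓝 (∫⁻ v, {v : Fin d → ℝ | ∑ i, increments 0 v i ^ 2 ≤ 2 / c}.indicator
        (fun _ => ENNReal.ofReal (polygonIntegral (d + 1) p)) v)) := by
    refine tendsto_lintegral_filter_of_dominated_convergence
      ({v : Fin d → ℝ | ∑ i, increments 0 v i ^ 2 ≤ 1 / κ}.indicator fun _ => ENNReal.ofReal B)
      (Eventually.of_forall fun η => ?_) ?_ ?_ ?_
    · have hm : Measurable fun v : Fin d → ℝ => regularAngles d + η • v := by fun_prop
      exact (hRc.measurable.indicator ((measurableSet_strictMono d).inter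
        (measurableSet_sublevel hgc.measurable _))).comp hm
    -- Domination: quadratic growth confines the rescaled sublevel sets, uniformly in `η`, to the
    -- fixed ellipsoid of level `1 / κ`, where the density is at most `B`.
    · filter_upwards [self_mem_nhdsWithin] with η (hη : 0 < η)
      refine Eventually.of_forall fun v => ?_
      by_cases hv : regularAngles d + η • v ∈ orderedSublevel d g (F + η ^ 2)
      · have hle : ∑ i, increments 0 v i ^ 2 ≤ 1 / κ := by
          obtain ⟨h1, h2, h3⟩ := hv
          have hmem : gap (Fin.cons (α := fun _ => ℝ) 0 (regularAngles d + η • v) :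
              Fin (d + 1) → ℝ) ∈ arcSimplex (d + 1) := by
            refine gap_mem_arcSimplex (fun i => ?_) ⟨0, by simp⟩
            refine Fin.cases ?_ (fun i => ?_) i
            · simpa using Real.pi_pos
            · rw [Fin.cons_succ]; exact h2 i
          have h4 := hgrow _ hmem
          rw [gap_cons_zero h1 fun i => (h2 i).1] at h4
          simp only [increments_regularAngles_add, add_sub_cancel_left, mul_pow, ← ha,
            ← Finset.mul_sum] at h4
          rw [hgapSum h1 h2] at h3
          have h5 : κ * (η ^ 2 * ∑ i, increments 0 v i ^ 2) ≤ η ^ 2 := by linarith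
          rw [le_div_iff₀ hκ]
          refine le_of_mul_le_mul_left ?_ (sq_pos_of_pos hη)
          linarith
        rw [indicator_of_mem (by exact hle)]
        simp only [Φ]
        rw [indicator_of_mem hv]
        exact ENNReal.ofReal_le_ofReal (hB _)
      · simp only [Φ]
        rw [indicator_of_notMem hv]
        exact bot_le
    · have hms : MeasurableSet {v : Fin d → ℝ | ∑ i, increments 0 v i ^ 2 ≤ 1 / κ} :=
        measurableSet_le (continuous_finsetSum _ fun i _ =>
          (continuous_increments 0 i).pow 2).measurable measurable_const
      rw [lintegral_indicator hms, setLIntegral_const, volume_ellipsoid_le hd (by positivity)]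
      exact ENNReal.mul_ne_top ENNReal.ofReal_ne_top ENNReal.ofReal_ne_top
    · filter_upwards [ae_sum_sq_increments_ne hd (ρ := 2 / c) (by positivity)] with v hv
      have hT := tendsto_sum_increments_div_sq hg v
      rw [← ha, ← hc, ← hF] at hT
      have hev := eventually_regularAngles_add_mem d v
      rcases lt_or_gt_of_ne hv with hlt | hgt
      · rw [indicator_of_mem (by exact hlt.le)]
        have h1 : c / 2 * ∑ i, increments 0 v i ^ 2 < 1 := by
          rw [lt_div_iff₀ hpos] at hlt; linarith
        have hden : Tendsto (fun η : ℝ => ENNReal.ofReal (angleDensity p (regularAngles d + η • v)))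
            (𝓝[>] 0) (𝓝 (ENNReal.ofReal (polygonIntegral (d + 1) p))) := by
          have hcont : Continuous fun η : ℝ => regularAngles d + η • v := by fun_prop
          have h : Tendsto
              (fun η : ℝ => ENNReal.ofReal (angleDensity p (regularAngles d + η • v))) (𝓝[>] 0)
              (𝓝 (ENNReal.ofReal (angleDensity p (regularAngles d + (0 : ℝ) • v)))) :=
            ((hRc.comp hcont).tendsto 0).mono_left nhdsWithin_le_nhds
          rwa [zero_smul, add_zero, angleDensity_regularAngles] at h
        refine hden.congr' ?_
        filter_upwards [hev, hT.eventually_lt_const h1, self_mem_nhdsWithin]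
          with η h2 h3 (hη : 0 < η)
        have hmem : regularAngles d + η • v ∈ orderedSublevel d g (F + η ^ 2) := by
          refine ⟨h2.1, h2.2, ?_⟩
          rw [hgapSum h2.1 h2.2]
          rw [div_lt_one (sq_pos_of_pos hη)] at h3
          linarith
        simp only [Φ]
        rw [indicator_of_mem hmem]
      · rw [indicator_of_notMem (by exact not_le.2 hgt)]
        have h1 : 1 < c / 2 * ∑ i, increments 0 v i ^ 2 := by
          rw [div_lt_iff₀ hpos] at hgt; linarith
        refine tendsto_const_nhds.congr' ?_
        filter_upwards [hev, hT.eventually_const_lt h1, self_mem_nhdsWithin]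
          with η h2 h3 (hη : 0 < η)
        have hmem : regularAngles d + η • v ∉ orderedSublevel d g (F + η ^ 2) := by
          rintro ⟨-, -, h4⟩
          rw [hgapSum h2.1 h2.2] at h4
          rw [one_lt_div (sq_pos_of_pos hη)] at h3
          linarith
        simp only [Φ]
        rw [indicator_of_notMem hmem]
  have hms : MeasurableSet {v : Fin d → ℝ | ∑ i, increments 0 v i ^ 2 ≤ 2 / c} :=
    measurableSet_le (continuous_finsetSum _ fun i _ =>
      (continuous_increments 0 i).pow 2).measurable measurable_const
  have hpoly : 0 ≤ polygonIntegral (d + 1) p := by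
    rw [← angleDensity_regularAngles]; exact angleDensity_nonneg hp0 _
  rw [lintegral_indicator hms, setLIntegral_const, volume_ellipsoid_le hd (by positivity),
    ← ENNReal.ofReal_mul hpoly] at hlim
  have hG : 0 < Real.Gamma ((d : ℝ) / 2 + 1) := Real.Gamma_pos_of_pos (by positivity)
  have hell : 0 ≤ ellipsoidVolume d (2 / c) := by unfold ellipsoidVolume; positivity
  have h1 := ((ENNReal.tendsto_toReal ENNReal.ofReal_ne_top).comp hlim).const_mul
    (d.factorial : ℝ)
  rw [ENNReal.toReal_ofReal (mul_nonneg hpoly hell)] at h1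
  refine h1.congr' ?_
  filter_upwards [self_mem_nhdsWithin] with η (hη : 0 < η)
  rw [measureReal_def, pi_circleLaw_kernel_le hp hp0 hper hgc.measurable,
    setLIntegral_sublevel hp hgc.measurable _ hη, ENNReal.toReal_mul, ENNReal.toReal_mul,
    ENNReal.toReal_natCast, ENNReal.toReal_ofReal (by positivity)]
  simp only [Function.comp_apply, Φ]
  field_simp

/-! ### Counting pairs of overlapping tuples -/

/-- The set of values of an increasing tuple. -/
def tupleSupport {m n : ℕ} (J : Fin m ↪o Fin n) : Finset (Fin n) := Finset.univ.map J.toEmbedding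

theorem mem_tupleSupport {m n : ℕ} (J : Fin m ↪o Fin n) (k : Fin m) : J k ∈ tupleSupport J :=
  Finset.mem_map_of_mem _ (Finset.mem_univ k)

theorem card_tupleSupport {m n : ℕ} (J : Fin m ↪o Fin n) : (tupleSupport J).card = m := by
  simp [tupleSupport]

theorem tupleSupport_injective {m n : ℕ} :
    Function.Injective (tupleSupport : (Fin m ↪o Fin n) → Finset (Fin n)) := by
  intro J J' h
  rw [Finset.orderEmbOfFin_unique' (card_tupleSupport J') (f := J)
    fun k => h ▸ mem_tupleSupport J k]
  exact (Finset.orderEmbOfFin_unique' (card_tupleSupport J') (mem_tupleSupport J')).symm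

theorem card_orderEmbedding_fin (m n : ℕ) : Fintype.card (Fin m ↪o Fin n) = n.choose m := by
  have h := Finset.card_powersetCard m (Finset.univ : Finset (Fin n))
  rw [Finset.card_univ, Fintype.card_fin] at h
  rw [← h, ← Finset.card_univ]
  refine Finset.card_bij (fun J _ => tupleSupport J) (fun J _ => ?_)
    (fun J _ J' _ h => tupleSupport_injective h) fun s hs => ?_
  · rw [Finset.mem_powersetCard]
    exact ⟨Finset.subset_univ _, card_tupleSupport J⟩
  · rw [Finset.mem_powersetCard] at hs
    exact ⟨s.orderEmbOfFin hs.2, Finset.mem_univ _, Finset.map_orderEmbOfFin_univ s hs.2⟩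

/-- A pair is encoded by the increasing enumeration of its union, one of at most `n ^ s` maps, and
by the positions of the two tuples inside it, at most `s ^ m` each. Only the power of `n` matters
later. -/
theorem card_pairs_le (m n s : ℕ) :
    (Finset.univ.filter fun P : (Fin m ↪o Fin n) × (Fin m ↪o Fin n) =>
      (tupleSupport P.1 ∪ tupleSupport P.2).card = s).card ≤ n ^ s * (s ^ m * s ^ m) := by
  classical
  let φ : (Fin m ↪o Fin n) × (Fin m ↪o Fin n) → (Fin m → Fin n) × (Fin m → Fin n) :=
    fun P => (P.1, P.2)
  have hφ : Function.Injective φ := by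
    intro P P' h
    have h' := Prod.ext_iff.1 h
    exact Prod.ext (DFunLike.coe_injective h'.1) (DFunLike.coe_injective h'.2)
  let ψ : (Fin s → Fin n) × (Fin m → Fin s) × (Fin m → Fin s) →
      (Fin m → Fin n) × (Fin m → Fin n) := fun w => (w.1 ∘ w.2.1, w.1 ∘ w.2.2)
  rw [← Finset.card_image_of_injective _ hφ]
  calc _ ≤ (Finset.univ.image ψ).card := by
        refine Finset.card_le_card fun f hf => ?_
        obtain ⟨P, hP, rfl⟩ := Finset.mem_image.1 hf
        rw [Finset.mem_filter] at hP
        set T := tupleSupport P.1 ∪ tupleSupport P.2 with hT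
        have hrange : ∀ x ∈ T, ∃ k, T.orderEmbOfFin hP.2 k = x := fun x hx => by
          have : x ∈ Set.range (T.orderEmbOfFin hP.2) := by
            rw [Finset.range_orderEmbOfFin]; exact hx
          exact this
        choose a ha using fun k => hrange (P.1 k)
          (Finset.mem_union_left _ (mem_tupleSupport P.1 k))
        choose b hb using fun k => hrange (P.2 k)
          (Finset.mem_union_right _ (mem_tupleSupport P.2 k))
        exact Finset.mem_image.2 ⟨(T.orderEmbOfFin hP.2, a, b), Finset.mem_univ _,
          Prod.ext (funext ha) (funext hb)⟩
    _ ≤ _ := Finset.card_image_le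
    _ = n ^ s * (s ^ m * s ^ m) := by simp

theorem sum_pairs_le {m n : ℕ} {S : Finset ((Fin m ↪o Fin n) × (Fin m ↪o Fin n))} {I : Finset ℕ}
    (hS : ∀ P ∈ S, (tupleSupport P.1 ∪ tupleSupport P.2).card ∈ I) {W : ℕ → ℝ}
    (hW : ∀ s, 0 ≤ W s) :
    ∑ P ∈ S, W (tupleSupport P.1 ∪ tupleSupport P.2).card ≤
      ∑ s ∈ I, (n : ℝ) ^ s * ((s : ℝ) ^ m * (s : ℝ) ^ m) * W s := by
  rw [← Finset.sum_fiberwise_of_maps_to hS]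
  refine Finset.sum_le_sum fun s _ => ?_
  calc ∑ P ∈ S with (tupleSupport P.1 ∪ tupleSupport P.2).card = s,
        W (tupleSupport P.1 ∪ tupleSupport P.2).card
      = ∑ P ∈ S with (tupleSupport P.1 ∪ tupleSupport P.2).card = s, W s :=
        Finset.sum_congr rfl fun P hP => by rw [(Finset.mem_filter.1 hP).2]
    _ = ((S.filter fun P => (tupleSupport P.1 ∪ tupleSupport P.2).card = s).card : ℝ) * W s := by
        rw [Finset.sum_const, nsmul_eq_mul]
    _ ≤ _ := by
        refine mul_le_mul_of_nonneg_right ?_ (hW s)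
        have h := (Finset.card_le_card (Finset.filter_subset_filter _ (Finset.subset_univ S))).trans
          (card_pairs_le m n s)
        exact_mod_cast h

/-! ### The Poisson limit -/

section Limit

variable {Ω : Type*} [MeasurableSpace Ω] {μ : Measure Ω} [IsProbabilityMeasure μ]

/-- Conditionally on the reference point `U r`, each of the other `S.card - 1` independent points
costs a factor `ρ`. -/
theorem prob_le_pow_card_sub_one {ι : Type*} [DecidableEq ι] {U : ι → Ω → Circle}
    (hU : ∀ i, Measurable (U i)) (hind : iIndepFun U μ) {ν : Measure Circle}
    [IsProbabilityMeasure ν] (hlaw : ∀ i, μ.map (U i) = ν) {m : ℕ} {ρ δ : ℝ} (hρ : 0 ≤ ρ)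
    (hν : ∀ z, ν {w | dist (w ^ m) (z ^ m) ≤ δ} ≤ ENNReal.ofReal ρ) {S : Finset ι} {r : ι}
    (hr : r ∈ S) {E : Set Ω} (hE : ∀ ω ∈ E, ∀ i ∈ S, dist (U i ω ^ m) (U r ω ^ m) ≤ δ) :
    μ.real E ≤ ρ ^ (S.card - 1) := by
  have hR : MeasurableSet {zw : Circle × Circle | dist (zw.2 ^ m) (zw.1 ^ m) ≤ δ} :=
    (isClosed_le (by fun_prop) continuous_const).measurableSet
  have h := prob_forall_mem_le hU hind hlaw hR (q := ENNReal.ofReal ρ) hν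
    (Finset.notMem_erase r S)
  rw [Finset.card_erase_of_mem hr, ← ENNReal.ofReal_pow hρ] at h
  refine ENNReal.toReal_le_of_le_ofReal (by positivity) ((measure_mono fun ω hω => ?_).trans h)
  exact fun i hi => hE ω hω i (Finset.mem_of_mem_erase hi)

/-- The neighbourhood of a tuple consists of the tuples sharing an index with it; those outside
depend on other points and are independent of it. A shared index limits the union to `2d + 1`
elements. The first sum starts at `d + 1` because a tuple is its own neighbour, the second at `d +
2` because two distinct tuples have a larger union. -/
theorem abs_prob_none_sub_exp_choose_le {α : Type*} [MeasurableSpace α] {d n : ℕ}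
    {U : Fin n → Ω → α} (hU : ∀ i, Measurable (U i)) (hind : iIndepFun U μ) {ν : Measure α}
    (hlaw : ∀ i, μ.map (U i) = ν) {E : Set (Fin (d + 1) → α)} (hE : MeasurableSet E) {ρ : ℝ}
    (hρ : 0 ≤ ρ)
    (hpair : ∀ J J' : Fin (d + 1) ↪o Fin n, ¬ Disjoint (tupleSupport J) (tupleSupport J') →
      μ.real ({ω | (fun k => U (J k) ω) ∈ E} ∩ {ω | (fun k => U (J' k) ω) ∈ E}) ≤
        ρ ^ ((tupleSupport J ∪ tupleSupport J').card - 1)) :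
    |μ.real {ω | ∀ J : Fin (d + 1) ↪o Fin n, (fun k => U (J k) ω) ∉ E} -
        Real.exp (-((n.choose (d + 1) : ℝ) * (Measure.pi fun _ : Fin (d + 1) => ν).real E))| ≤
      ∑ s ∈ Finset.Icc (d + 1) (2 * d + 1),
        (n : ℝ) ^ s * ((s : ℝ) ^ (d + 1) * (s : ℝ) ^ (d + 1)) * ρ ^ (2 * d) +
      ∑ s ∈ Finset.Icc (d + 2) (2 * d + 1),
        (n : ℝ) ^ s * ((s : ℝ) ^ (d + 1) * (s : ℝ) ^ (d + 1)) * ρ ^ (s - 1) := by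
  classical
  let A : (Fin (d + 1) ↪o Fin n) → Set Ω := fun J => {ω | (fun k => U (J k) ω) ∈ E}
  let N : (Fin (d + 1) ↪o Fin n) → Finset (Fin (d + 1) ↪o Fin n) := fun J =>
    Finset.univ.filter fun J' => ¬ Disjoint (tupleSupport J) (tupleSupport J')
  have htuple (J : Fin (d + 1) ↪o Fin n) : Measurable fun ω k => U (J k) ω :=
    measurable_pi_lambda _ fun k => hU (J k)
  have hA (J) : MeasurableSet (A J) := htuple J hE
  have hself (J : Fin (d + 1) ↪o Fin n) : ¬ Disjoint (tupleSupport J) (tupleSupport J) := by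
    rw [disjoint_self, Finset.bot_eq_empty, ← Finset.card_eq_zero, card_tupleSupport]
    exact Nat.succ_ne_zero d
  have hN (J) : J ∈ N J := by simpa [N] using hself J
  have hprob (J) : μ.real (A J) = (Measure.pi fun _ : Fin (d + 1) => ν).real E := by
    rw [← map_tuple_eq_pi hU hind hlaw J.injective, map_measureReal_apply (htuple J) hE]
    rfl
  have hindep (J) : IndepFun ((A J).indicator (1 : Ω → ℝ))
      (fun ω (J' : {J' // J' ∉ N J}) => (A J').indicator (1 : Ω → ℝ) ω) μ := by
    have h := hind.indepFun_finset (tupleSupport J) (tupleSupport J)ᶜ disjoint_compl_right hU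
    let φ : ((tupleSupport J) → α) → ℝ := fun v =>
      E.indicator 1 fun k => v ⟨J k, mem_tupleSupport J k⟩
    have hφ : Measurable φ := (measurable_one.indicator hE).comp
      (measurable_pi_lambda _ fun k => measurable_pi_apply _)
    have hmem (J' : {J' // J' ∉ N J}) (k) : (J' : Fin (d + 1) ↪o Fin n) k ∈ (tupleSupport J)ᶜ := by
      have hJ' : Disjoint (tupleSupport J) (tupleSupport (J' : Fin (d + 1) ↪o Fin n)) := by
        simpa [N] using J'.2
      exact Finset.mem_compl.2 (Finset.disjoint_right.1 hJ' (mem_tupleSupport _ k))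
    let ψ : (((tupleSupport J)ᶜ : Finset (Fin n)) → α) → {J' // J' ∉ N J} → ℝ := fun v J' =>
      E.indicator 1 fun k => v ⟨(J' : Fin (d + 1) ↪o Fin n) k, hmem J' k⟩
    have hψ : Measurable ψ := measurable_pi_lambda _ fun J' => (measurable_one.indicator hE).comp
      (measurable_pi_lambda _ fun k => measurable_pi_apply _)
    exact h.comp hφ hψ
  have h := abs_prob_none_sub_exp_le (μ := μ) hA hN hindep
  have hΛ : ∑ J, μ.real (A J) =
      (n.choose (d + 1) : ℝ) * (Measure.pi fun _ : Fin (d + 1) => ν).real E := by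
    simp only [hprob, Finset.sum_const, Finset.card_univ, card_orderEmbedding_fin, nsmul_eq_mul]
  rw [hΛ] at h
  refine h.trans (add_le_add ?_ ?_)
  -- The bound for a single tuple is the diagonal case of `hpair`.
  · have hp (J) : μ.real (A J) ≤ ρ ^ d := by
      have := hpair J J (hself J)
      rwa [Set.inter_self, Finset.union_self, card_tupleSupport, Nat.add_sub_cancel] at this
    let S : Finset ((Fin (d + 1) ↪o Fin n) × (Fin (d + 1) ↪o Fin n)) :=
      Finset.univ.filter fun P => ¬ Disjoint (tupleSupport P.1) (tupleSupport P.2)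
    have hS : ∀ P ∈ S, (tupleSupport P.1 ∪ tupleSupport P.2).card ∈
        Finset.Icc (d + 1) (2 * d + 1) := by
      intro P hP
      have hP' : ¬ Disjoint (tupleSupport P.1) (tupleSupport P.2) := by simpa [S] using hP
      have h1 := Finset.card_union_add_card_inter (tupleSupport P.1) (tupleSupport P.2)
      rw [card_tupleSupport, card_tupleSupport] at h1
      have h2 : 0 < (tupleSupport P.1 ∩ tupleSupport P.2).card :=
        Finset.card_pos.2 (Finset.not_disjoint_iff_nonempty_inter.1 hP')
      have h3 := Finset.card_le_card (Finset.subset_union_left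
        (s₁ := tupleSupport P.1) (s₂ := tupleSupport P.2))
      rw [card_tupleSupport] at h3
      rw [Finset.mem_Icc]
      omega
    refine le_trans ?_ (sum_pairs_le hS (W := fun _ => ρ ^ (2 * d)) fun _ => by positivity)
    rw [Finset.sum_finset_product S Finset.univ N (by intro P; simp [S, N])]
    refine Finset.sum_le_sum fun J _ => Finset.sum_le_sum fun J' _ => ?_
    rw [two_mul, pow_add]
    exact mul_le_mul (hp J) (hp J') measureReal_nonneg (by positivity)
  · let S : Finset ((Fin (d + 1) ↪o Fin n) × (Fin (d + 1) ↪o Fin n)) :=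
      Finset.univ.filter fun P => ¬ Disjoint (tupleSupport P.1) (tupleSupport P.2) ∧ P.2 ≠ P.1
    have hS : ∀ P ∈ S, (tupleSupport P.1 ∪ tupleSupport P.2).card ∈
        Finset.Icc (d + 2) (2 * d + 1) := by
      intro P hP
      have hP' : ¬ Disjoint (tupleSupport P.1) (tupleSupport P.2) ∧ P.2 ≠ P.1 := by
        simpa [S] using hP
      have h1 := Finset.card_union_add_card_inter (tupleSupport P.1) (tupleSupport P.2)
      rw [card_tupleSupport, card_tupleSupport] at h1
      have h2 : 0 < (tupleSupport P.1 ∩ tupleSupport P.2).card :=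
        Finset.card_pos.2 (Finset.not_disjoint_iff_nonempty_inter.1 hP'.1)
      have h3 : d + 1 < (tupleSupport P.1 ∪ tupleSupport P.2).card := by
        by_contra! hle
        have e1 := Finset.eq_of_subset_of_card_le (Finset.subset_union_left
          (s₁ := tupleSupport P.1) (s₂ := tupleSupport P.2)) (by rwa [card_tupleSupport])
        have e2 := Finset.eq_of_subset_of_card_le (Finset.subset_union_right
          (s₁ := tupleSupport P.1) (s₂ := tupleSupport P.2)) (by rwa [card_tupleSupport])
        exact hP'.2 (tupleSupport_injective (e2.trans e1.symm))
      rw [Finset.mem_Icc]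
      omega
    refine le_trans ?_ (sum_pairs_le hS (W := fun s => ρ ^ (s - 1)) fun _ => by positivity)
    rw [Finset.sum_finset_product S Finset.univ (fun J => (N J).erase J)
      (by intro P; simp [S, N, and_comm])]
    refine Finset.sum_le_sum fun J _ => Finset.sum_le_sum fun J' hJ' => hpair J J' ?_
    simpa [N] using Finset.mem_of_mem_erase hJ'

theorem tendsto_pow_mul_rpow_pow {c β : ℝ} {s k : ℕ} (h : (s : ℝ) < β * k) :
    Tendsto (fun n : ℕ => (n : ℝ) ^ s * (c * (n : ℝ) ^ (-β)) ^ k) atTop (𝓝 0) := by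
  have h1 := ((tendsto_rpow_neg_atTop (sub_pos.2 h)).comp tendsto_natCast_atTop_atTop).const_mul
    (c ^ k)
  rw [mul_zero] at h1
  refine h1.congr' ?_
  filter_upwards [eventually_gt_atTop 0] with n hn
  have hn' : (0 : ℝ) < n := by exact_mod_cast hn
  simp only [Function.comp_apply]
  rw [mul_pow, ← Real.rpow_natCast ((n : ℝ) ^ (-β)) k, ← Real.rpow_mul hn'.le,
    ← Real.rpow_natCast (n : ℝ) s, mul_left_comm, ← Real.rpow_add hn']
  congr 2
  ring

theorem limitConst_eq {d : ℕ} {g p : ℝ → ℝ}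
    (hpos : 0 < iteratedDeriv 2 g (2 * Real.pi / ((d + 1 : ℕ) : ℝ))) :
    limitConst (d + 1) g p = polygonIntegral (d + 1) p *
      ellipsoidVolume d (2 / iteratedDeriv 2 g (2 * Real.pi / ((d + 1 : ℕ) : ℝ))) := by
  unfold limitConst ellipsoidVolume
  set c := iteratedDeriv 2 g (2 * Real.pi / ((d + 1 : ℕ) : ℝ)) with hc
  have hpi := Real.pi_pos
  have hG : 0 < Real.Gamma ((d : ℝ) / 2 + 1) := Real.Gamma_pos_of_pos (by positivity)
  have e1 : (((d + 1 : ℕ) : ℝ) - 1) / 2 = 1 / 2 * d := by push_cast; ring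
  have e2 : (((d + 1 : ℕ) : ℝ) + 1) / 2 = (d : ℝ) / 2 + 1 := by push_cast; ring
  have e3 : Real.sqrt ((d + 1 : ℕ) : ℝ) = Real.sqrt (d + 1) := by push_cast; rfl
  have e4 {x : ℝ} (hx : 0 ≤ x) : x ^ (1 / 2 * (d : ℝ)) = Real.sqrt x ^ d := by
    rw [Real.rpow_mul hx, ← Real.sqrt_eq_rpow, Real.rpow_natCast]
  rw [e1, e2, e3, e4 (by positivity), e4 hpos.le, Real.sqrt_div (by norm_num),
    Real.sqrt_mul (by norm_num), div_pow, mul_pow]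
  field_simp

/-- The scale `η n = √t · n^(-β)` with `β = (d + 1)/d` is chosen so that `n^(d+1) η^d = t^(d/2)`,
which keeps the expected number of successful tuples bounded away from zero and infinity when the
limit constant is positive. -/
theorem tendsto_prob_none {d : ℕ} (hd : 0 < d) {g : ℝ → ℝ} (hgc : Continuous g)
    (hg : ContDiffAt ℝ 2 g (2 * Real.pi / ((d + 1 : ℕ) : ℝ)))
    (hpos : 0 < iteratedDeriv 2 g (2 * Real.pi / ((d + 1 : ℕ) : ℝ)))
    (hmin : RegularPolygonUniqueMin (d + 1) g)
    {p : ℝ → ℝ} (hp : Continuous p) (hp0 : ∀ x, 0 ≤ p x)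
    (hper : Function.Periodic p (2 * Real.pi))
    {U : ℕ → Ω → Circle} (hU : ∀ i, Measurable (U i)) (hind : iIndepFun U μ)
    (hlaw : ∀ i, μ.map (U i) = circleLaw p) {t : ℝ} (ht : 0 < t) :
    Tendsto (fun n : ℕ => μ.real {ω | ∀ J : Fin (d + 1) ↪o Fin n,
        (fun k => U (J k) ω) ∉ {u : Fin (d + 1) → Circle | kernel g u ≤
          ((d + 1 : ℕ) : ℝ) * g (2 * Real.pi / ((d + 1 : ℕ) : ℝ)) +
            (Real.sqrt t * (n : ℝ) ^ (-(((d + 1 : ℕ) : ℝ) / d))) ^ 2}}) atTop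
      (𝓝 (Real.exp (-(Real.sqrt t ^ d * limitConst (d + 1) g p / ((d + 1 : ℕ) : ℝ))))) := by
  have hprobLaw : IsProbabilityMeasure (circleLaw p) := by
    rw [← hlaw 0]; exact Measure.isProbabilityMeasure_map (hU 0).aemeasurable
  have hdR : (0 : ℝ) < d := by exact_mod_cast hd
  set F : ℝ := ((d + 1 : ℕ) : ℝ) * g (2 * Real.pi / ((d + 1 : ℕ) : ℝ)) with hF
  set β : ℝ := ((d + 1 : ℕ) : ℝ) / d with hβ
  have hβ0 : 0 < β := by positivity
  set η : ℕ → ℝ := fun n => Real.sqrt t * (n : ℝ) ^ (-β) with hη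
  have hη0 (n) : 0 ≤ η n := by simp only [hη]; positivity
  obtain ⟨C₁, hC₁, hclose⟩ := exists_dist_pow_le hgc hg hpos hmin
  obtain ⟨C₂, hC₂, harc⟩ := exists_circleLaw_dist_pow_le hp hper (Nat.succ_pos d)
  let E : ℕ → Set (Fin (d + 1) → Circle) := fun n => {u | kernel g u ≤ F + η n ^ 2}
  have hE (n) : MeasurableSet (E n) :=
    measurableSet_le (measurable_kernel hgc.measurable) measurable_const
  set c : ℝ := C₂ * (C₁ * Real.sqrt t) with hc
  have hbound (n : ℕ) := abs_prob_none_sub_exp_choose_le (μ := μ) (U := fun i : Fin n => U i)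
    (fun i => hU i) (hind.precomp Fin.val_injective) (fun i => hlaw i) (hE n)
    (ρ := c * (n : ℝ) ^ (-β)) (by positivity) (fun J J' hJJ' => by
      -- A common index `r` serves as reference for both tuples, so every point of the union has its
      -- power close to that of `U r`.
      obtain ⟨r, hr, hr'⟩ := Finset.not_disjoint_iff.1 hJJ'
      have hceq : c * (n : ℝ) ^ (-β) = C₂ * (C₁ * η n) := by simp only [hc, hη]; ring
      rw [hceq]
      refine prob_le_pow_card_sub_one (U := fun i : Fin n => U i) (fun i => hU i)
        (hind.precomp Fin.val_injective) (fun i => hlaw i) (m := d + 1) (δ := C₁ * η n)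
        (by have := hη0 n; positivity) (fun z => harc z _ (by have := hη0 n; positivity))
        (Finset.mem_union_left _ hr) fun ω hω i hi => ?_
      obtain ⟨k, -, hk⟩ := Finset.mem_map.1 hr
      obtain ⟨k', -, hk'⟩ := Finset.mem_map.1 hr'
      rcases Finset.mem_union.1 hi with hi | hi
      · obtain ⟨l, -, hl⟩ := Finset.mem_map.1 hi
        rw [← hk, ← hl]
        exact hclose _ (hη0 n) _ hω.1 l k
      · obtain ⟨l, -, hl⟩ := Finset.mem_map.1 hi
        rw [← hk', ← hl]
        exact hclose _ (hη0 n) _ hω.2 l k')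
  have herr : Tendsto (fun n : ℕ => ∑ s ∈ Finset.Icc (d + 1) (2 * d + 1),
        (n : ℝ) ^ s * ((s : ℝ) ^ (d + 1) * (s : ℝ) ^ (d + 1)) * (c * (n : ℝ) ^ (-β)) ^ (2 * d) +
      ∑ s ∈ Finset.Icc (d + 2) (2 * d + 1),
        (n : ℝ) ^ s * ((s : ℝ) ^ (d + 1) * (s : ℝ) ^ (d + 1)) * (c * (n : ℝ) ^ (-β)) ^ (s - 1))
      atTop (𝓝 0) := by
    rw [← add_zero (0 : ℝ)]
    refine Tendsto.add ?_ ?_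
    -- Here `β · 2d = 2(d + 1)`, which exceeds every `s ≤ 2d + 1`.
    · rw [← Finset.sum_const_zero (s := Finset.Icc (d + 1) (2 * d + 1))]
      refine tendsto_finsetSum _ fun s hs => ?_
      have hs' : s < 2 * (d + 1) := by have := (Finset.mem_Icc.1 hs).2; omega
      have hlt : (s : ℝ) < β * ((2 * d : ℕ) : ℝ) := by
        have : β * ((2 * d : ℕ) : ℝ) = ((2 * (d + 1) : ℕ) : ℝ) := by
          rw [hβ]; push_cast; field_simp
        rw [this]; exact_mod_cast hs'
      have h := (tendsto_pow_mul_rpow_pow (c := c) hlt).const_mul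
        ((s : ℝ) ^ (d + 1) * (s : ℝ) ^ (d + 1))
      rw [mul_zero] at h
      exact h.congr fun n => by ring
    -- The inequality `s < β (s - 1)` is equivalent to `s > d + 1`; this is where distinctness of
    -- the two tuples is decisive.
    · rw [← Finset.sum_const_zero (s := Finset.Icc (d + 2) (2 * d + 1))]
      refine tendsto_finsetSum _ fun s hs => ?_
      have hs' : d + 2 ≤ s := (Finset.mem_Icc.1 hs).1
      have hlt : (s : ℝ) < β * ((s - 1 : ℕ) : ℝ) := by
        have h1 : (d : ℝ) + 2 ≤ s := by exact_mod_cast hs'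
        rw [hβ, Nat.cast_sub (by omega), div_mul_eq_mul_div, lt_div_iff₀ hdR]
        push_cast
        nlinarith
      have h := (tendsto_pow_mul_rpow_pow (c := c) hlt).const_mul
        ((s : ℝ) ^ (d + 1) * (s : ℝ) ^ (d + 1))
      rw [mul_zero] at h
      exact h.congr fun n => by ring
  have hηpos : ∀ᶠ n : ℕ in atTop, 0 < η n := by
    filter_upwards [eventually_gt_atTop 0] with n hn
    have hn' : (0 : ℝ) < n := by exact_mod_cast hn
    simp only [hη]
    positivity
  have hηlim : Tendsto η atTop (𝓝[>] 0) := by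
    rw [tendsto_nhdsWithin_iff]
    refine ⟨?_, hηpos⟩
    have := ((tendsto_rpow_neg_atTop hβ0).comp tendsto_natCast_atTop_atTop).const_mul (Real.sqrt t)
    rwa [mul_zero] at this
  have hasym := (tendsto_pi_circleLaw_kernel_le hd hgc hg hpos hmin hp hp0 hper).comp hηlim
  rw [← limitConst_eq hpos] at hasym
  have hchoose : Tendsto (fun n : ℕ => (n.choose (d + 1) : ℝ) / (n : ℝ) ^ (d + 1)) atTop
      (𝓝 (1 / ((d + 1).factorial : ℝ))) := by
    have h := isEquivalent_choose (d + 1)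
    have h2 := (Asymptotics.isEquivalent_iff_tendsto_one (by
      filter_upwards [eventually_gt_atTop 0] with n hn
      have hn' : (0 : ℝ) < n := by exact_mod_cast hn
      positivity)).1 h
    have h3 := h2.div_const ((d + 1).factorial : ℝ)
    refine h3.congr fun n => ?_
    simp only [Pi.div_apply]
    field_simp
  have hmean : Tendsto (fun n : ℕ => (n.choose (d + 1) : ℝ) *
      (Measure.pi fun _ : Fin (d + 1) => circleLaw p).real (E n)) atTop
      (𝓝 (Real.sqrt t ^ d * limitConst (d + 1) g p / ((d + 1 : ℕ) : ℝ))) := by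
    have h := (hchoose.mul hasym).mul_const (Real.sqrt t ^ d)
    -- The `d!` orderings of the angles against the `(d + 1)!` of the binomial coefficient leave the
    -- factor `1/m` of the limit law.
    have hlim : 1 / ((d + 1).factorial : ℝ) * (d.factorial * limitConst (d + 1) g p) *
        Real.sqrt t ^ d = Real.sqrt t ^ d * limitConst (d + 1) g p / ((d + 1 : ℕ) : ℝ) := by
      rw [Nat.factorial_succ]
      have : (d.factorial : ℝ) ≠ 0 := by exact_mod_cast d.factorial_ne_zero
      push_cast
      field_simp
    rw [hlim] at h
    refine h.congr' ?_
    filter_upwards [eventually_gt_atTop 0] with n hn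
    have hn' : (0 : ℝ) < n := by exact_mod_cast hn
    have hpow : η n ^ d * (n : ℝ) ^ (d + 1) = Real.sqrt t ^ d := by
      simp only [hη]
      rw [mul_pow, ← Real.rpow_natCast ((n : ℝ) ^ (-β)) d, ← Real.rpow_mul hn'.le,
        ← Real.rpow_natCast (n : ℝ) (d + 1), mul_assoc, ← Real.rpow_add hn']
      have : -β * d + ((d + 1 : ℕ) : ℝ) = 0 := by rw [hβ]; field_simp; ring
      rw [this, Real.rpow_zero, mul_one]
    have hsqrt : 0 < Real.sqrt t := Real.sqrt_pos.2 ht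
    have hη1 : 0 < η n := by simp only [hη]; positivity
    simp only [Function.comp_apply]
    rw [← hpow]
    simp only [E, hF]
    field_simp
  have hexp : Tendsto (fun n : ℕ => Real.exp (-((n.choose (d + 1) : ℝ) *
      (Measure.pi fun _ : Fin (d + 1) => circleLaw p).real (E n)))) atTop _ :=
    (Real.continuous_exp.tendsto _).comp hmean.neg
  have hdiff : Tendsto (fun n : ℕ => μ.real {ω | ∀ J : Fin (d + 1) ↪o Fin n,
      (fun k => U (J k) ω) ∉ E n} - Real.exp (-((n.choose (d + 1) : ℝ) *
      (Measure.pi fun _ : Fin (d + 1) => circleLaw p).real (E n)))) atTop (𝓝 0) :=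
    squeeze_zero_norm hbound herr
  have hfinal := hdiff.add hexp
  rw [zero_add] at hfinal
  exact hfinal.congr fun n => sub_add_cancel _ _

end Limit

/-! ### The limit law of the minimum -/

theorem uMin_le_iff {α : Type*} {m n : ℕ} (hmn : m ≤ n) (f : (Fin m → α) → ℝ) (x : ℕ → α) (c : ℝ) :
    uMin f x n ≤ c ↔ ∃ J : Fin m ↪o Fin n, f (fun k => x (J k)) ≤ c := by
  have : Nonempty (Fin m ↪o Fin n) := ⟨Fin.castLEOrderEmb hmn⟩
  constructor
  · intro h
    obtain ⟨J, hJ⟩ := exists_eq_ciInf_of_finite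
      (f := fun J : Fin m ↪o Fin n => f fun k => x (J k))
    exact ⟨J, hJ.le.trans h⟩
  · rintro ⟨J, hJ⟩
    exact (ciInf_le (Set.finite_range _).bddBelow J).trans hJ

/-- For `n ≥ m` the event is the complement of the event that no tuple has excess at most `η²`,
because `η² = t · n^(-2m/(m-1))`. -/
theorem tendsto_prob_uMin_le {Ω : Type*} [MeasurableSpace Ω] {μ : Measure Ω}
    [IsProbabilityMeasure μ] {d : ℕ} (hd : 0 < d) {g : ℝ → ℝ} (hgc : Continuous g)
    (hg : ContDiffAt ℝ 2 g (2 * Real.pi / ((d + 1 : ℕ) : ℝ)))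
    (hpos : 0 < iteratedDeriv 2 g (2 * Real.pi / ((d + 1 : ℕ) : ℝ)))
    (hmin : RegularPolygonUniqueMin (d + 1) g)
    {p : ℝ → ℝ} (hp : Continuous p) (hp0 : ∀ x, 0 ≤ p x)
    (hper : Function.Periodic p (2 * Real.pi))
    {U : ℕ → Ω → Circle} (hU : ∀ i, Measurable (U i)) (hind : iIndepFun U μ)
    (hlaw : ∀ i, μ.map (U i) = circleLaw p) {t : ℝ} (ht : 0 < t) :
    Tendsto
      (fun n : ℕ => μ.real {ω | (n : ℝ) ^ (2 * ((d + 1 : ℕ) : ℝ) / (((d + 1 : ℕ) : ℝ) - 1)) *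
        (uMin (kernel (m := d + 1) g) (fun i => U i ω) n -
          ((d + 1 : ℕ) : ℝ) * g (2 * Real.pi / ((d + 1 : ℕ) : ℝ))) ≤ t})
      atTop
      (𝓝 (1 - Real.exp (-(t ^ ((((d + 1 : ℕ) : ℝ) - 1) / 2) * limitConst (d + 1) g p /
        ((d + 1 : ℕ) : ℝ))))) := by
  have hdR : (0 : ℝ) < d := by exact_mod_cast hd
  have e1 : t ^ ((((d + 1 : ℕ) : ℝ) - 1) / 2) = Real.sqrt t ^ d := by
    rw [Real.sqrt_eq_rpow, ← Real.rpow_mul_natCast ht.le]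
    congr 1
    push_cast
    ring
  rw [e1]
  refine ((tendsto_prob_none hd hgc hg hpos hmin hp hp0 hper hU hind hlaw ht).const_sub 1).congr' ?_
  filter_upwards [eventually_ge_atTop (d + 1)] with n hn
  have hn' : (0 : ℝ) < n := by exact_mod_cast (Nat.succ_pos d).trans_le hn
  set F : ℝ := ((d + 1 : ℕ) : ℝ) * g (2 * Real.pi / ((d + 1 : ℕ) : ℝ)) with hF
  set η : ℝ := Real.sqrt t * (n : ℝ) ^ (-(((d + 1 : ℕ) : ℝ) / d)) with hη
  set E : Set (Fin (d + 1) → Circle) := {u | kernel g u ≤ F + η ^ 2} with hEdef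
  have hE : MeasurableSet E :=
    measurableSet_le (measurable_kernel hgc.measurable) measurable_const
  have hmeas : MeasurableSet {ω | ∀ J : Fin (d + 1) ↪o Fin n, (fun k => U (J k) ω) ∉ E} := by
    have : {ω | ∀ J : Fin (d + 1) ↪o Fin n, (fun k => U (J k) ω) ∉ E} =
        ⋂ J : Fin (d + 1) ↪o Fin n, ((fun ω k => U (J k) ω) ⁻¹' E)ᶜ := by
      ext; simp
    rw [this]
    exact MeasurableSet.iInter fun J =>
      ((measurable_pi_lambda _ fun k => hU (J k)) hE).compl
  refine (probReal_compl_eq_one_sub hmeas).symm.trans ?_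
  congr 1
  ext ω
  have hη2 : η ^ 2 = t * ((n : ℝ) ^ (2 * ((d + 1 : ℕ) : ℝ) / (((d + 1 : ℕ) : ℝ) - 1)))⁻¹ := by
    rw [hη, mul_pow, Real.sq_sqrt ht.le, ← Real.rpow_natCast, ← Real.rpow_mul hn'.le,
      ← Real.rpow_neg hn'.le]
    congr 2
    push_cast
    rw [add_sub_cancel_right]
    field_simp
  have hpow : 0 < (n : ℝ) ^ (2 * ((d + 1 : ℕ) : ℝ) / (((d + 1 : ℕ) : ℝ) - 1)) :=
    Real.rpow_pos_of_pos hn' _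
  simp only [mem_compl_iff, mem_ofPred_eq, not_forall, not_not]
  rw [← le_div_iff₀' hpow, sub_le_iff_le_add', uMin_le_iff hn, div_eq_mul_inv, ← hη2]
  rfl

end UMin

end

/-- Arcs lie in `[0, 2π]`, so `g` may be replaced by the continuous extension `G` that is constant
outside this interval. As `m ≥ 2`, the point `2π/m` is interior, and the derivatives there are
unchanged. -/
theorem corollary5p2 {Ω : Type*} [MeasurableSpace Ω] (μ : Measure Ω) [IsProbabilityMeasure μ]
    (m : ℕ) [NeZero m] (hm : 2 ≤ m)
    (g : ℝ → ℝ) (hg : ContinuousOn g (Icc 0 (2 * Real.pi)))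
    (hg3 : ContDiffAt ℝ 3 g (2 * Real.pi / (m : ℝ)))
    (hg2 : iteratedDeriv 2 g (2 * Real.pi / (m : ℝ)) ≠ 0)
    (p : ℝ → ℝ) (hp : Continuous p) (hp0 : ∀ x, 0 ≤ p x)
    (hper : Function.Periodic p (2 * Real.pi)) (hpos : 0 < UMin.polygonIntegral m p)
    (U : ℕ → Ω → Circle) (hU : ∀ i, Measurable (U i)) (hind : iIndepFun U μ)
    (hlaw : ∀ i, μ.map (U i) = UMin.circleLaw p) :
    (UMin.RegularPolygonUniqueMin m g →
      ∀ t : ℝ, 0 < t →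
        Tendsto
          (fun n : ℕ => μ.real {ω | (n : ℝ) ^ (2 * (m : ℝ) / ((m : ℝ) - 1)) *
            (UMin.uMin (UMin.kernel (m := m) g) (fun i => U i ω) n -
              (m : ℝ) * g (2 * Real.pi / (m : ℝ))) ≤ t})
          atTop
          (𝓝 (1 - Real.exp (-(t ^ (((m : ℝ) - 1) / 2) * UMin.limitConst m g p / (m : ℝ)))))) ∧
    (StrictConvexOn ℝ (Icc 0 (2 * Real.pi)) g → UMin.RegularPolygonUniqueMin m g) := by
  obtain ⟨d, rfl⟩ : ∃ d, m = d + 1 := ⟨m - 1, by omega⟩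
  have hd : 0 < d := by omega
  refine ⟨fun hmin t ht => ?_, UMin.regularPolygonUniqueMin_of_strictConvexOn⟩
  set a : ℝ := 2 * Real.pi / ((d + 1 : ℕ) : ℝ) with ha
  have haI : a ∈ Ioo 0 (2 * Real.pi) := by
    have hd' : (1 : ℝ) < ((d + 1 : ℕ) : ℝ) := by exact_mod_cast Nat.succ_lt_succ hd
    exact ⟨by positivity, div_lt_self Real.two_pi_pos hd'⟩
  let G : ℝ → ℝ := IccExtend Real.two_pi_pos.le ((Icc 0 (2 * Real.pi)).domRestrict g)
  have hGc : Continuous G := (continuousOn_iff_continuous_domRestrict.1 hg).Icc_extend'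
  have hGg : ∀ x ∈ Icc 0 (2 * Real.pi), G x = g x := fun x hx => IccExtend_of_mem _ _ hx
  have hGa : G =ᶠ[𝓝 a] g := by
    filter_upwards [Icc_mem_nhds haI.1 haI.2] with x hx using hGg x hx
  have hker : UMin.kernel (m := d + 1) G = UMin.kernel (m := d + 1) g := by
    funext u
    rw [UMin.kernel_eq_sum_arcs, UMin.kernel_eq_sum_arcs]
    exact Finset.sum_congr rfl fun i _ =>
      hGg _ (UMin.mem_Icc_of_mem_arcSimplex (UMin.arcs_mem_arcSimplex u) i)
  have hGmin : UMin.RegularPolygonUniqueMin (d + 1) G := by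
    unfold UMin.RegularPolygonUniqueMin
    rw [hker]
    exact hmin
  have hG2 : ContDiffAt ℝ 2 G a := (hg3.of_le (by norm_num)).congr_of_eventuallyEq hGa
  have hGd : iteratedDeriv 2 G a = iteratedDeriv 2 g a := hGa.iteratedDeriv_eq 2
  -- Minimality gives a nonnegative second derivative, and the hypothesis that it does not vanish
  -- makes it positive.
  have hpos2 : 0 < iteratedDeriv 2 G a :=
    lt_of_le_of_ne (UMin.iteratedDeriv_two_nonneg hd hG2 hGmin) (hGd ▸ hg2.symm)
  have h := UMin.tendsto_prob_uMin_le hd hGc hG2 hpos2 hGmin hp hp0 hper hU hind hlaw ht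
  have hconst : UMin.limitConst (d + 1) G p = UMin.limitConst (d + 1) g p := by
    unfold UMin.limitConst
    rw [hGd]
  rw [hconst, hker, hGg _ (Ioo_subset_Icc_self haI)] at h
  exact h
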